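/- All graphs are simple, undirected, finite and connected. Let $X=(X_n)_{n\in\mathbb N}$ be a sequence of such graphs. A sequence $Y=(Y_n)$ of connected graphs with $V(Y_n)=V(X_n)$ *induces the same coarse structure* as $X$ if there is a constant $L$ with $d_{X_n}(x,y)\le L\,d_{Y_n}(x,y)$ and $d_{Y_n}(x,y)\le L\,d_{X_n}(x,y)$ for all $n$ and all $x,y\in V(X_n)$ (path distances). The *combinatorial cost* of $X$ is $$c(X)=\inf_Y\ \liminf_{n\to\infty}\frac{|E(Y_n)|}{|V(X_n)|},$$ the infimum being over all sequences $Y$ inducing the same coarse structure as $X$. For a graph $G$ and an integer $R$, let $Z_R(G)$ be the subspace of the real vector space generated by the oriented edges of $G$, subject to $(x,y)=-(y,x)$, spanned by the elements $(x_1,x_2)+\dots+(x_{q-1},x_q)+(x_q,x_1)$ for all cycles $(x_1,\dots,x_q)$ of $G$ of length $q\le R$. Assume now that $X$ has uniformly bounded degree. The algebraic uniform Roe algebra $\mathbb C_{cs}[X]$ is the $*$-algebra of all $T=(T_n)\in\prod_n B(\ell^2V(X_n))$ (uniformly bounded operator norms) of finite propagation, i.e. such that for some $r$ the matrix entry $(T_n)_{xy}$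 vanishes for all $n$ and all $x,y$ with $d_{X_n}(x,y)>r$. The maximal uniform Roe algebra $C^*_{\max}(X)$ is its completion in the norm $\|T\|_{\max}=\sup_\pi\|\pi(T)\|$, over all unital $*$-homomorphisms $\pi$ from $\mathbb C_{cs}[X]$ to the bounded operators on a complex Hilbert space. The Laplacian $\Delta_X=(\Delta_{X_n})_n$, with $\Delta_{X_n}$ the degree matrix minus the adjacency matrix, is an element of $\mathbb C_{cs}[X]$. The sequence $X$ has *geometric property (T)* if its graphs are connected of uniformly bounded degree, $|V(X_n)|\to\infty$, and there is $\gamma>0$ such that the spectrum of $\Delta_X$ in $C^*_{\max}(X)$ is contained in $\{0\}\cup[\gamma,\infty)$. **Proposition.** (i) Suppose that all vertices of all $X_n$ have degree at most $d$ and that there are an integer $R>0$ and a real $\epsilon>0$ such that $\dim Z_R(X_n)\ge\epsilon|V(X_n)|$ for all $n$. Then $$c(X)\le\liminf_{n\to\infty}\frac{|E(X_n)|}{|V(X_n)|}-\frac{\epsilon}{d^{R-1}}.$$ (ii) If $X$ has geometric property (T), then the infimum defining $c(X)$ is not attained: there is no sequence $Y$ inducing the same coarse structure as $X$ with $\liminf_n\frac{|E(Y_n)|}{|V(X_n)|}=c(X)$.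 -/

import Mathlib

open Filter Topology

universe u

/-! ### Cycle spaces -/

section CycleSpaces

variable {W : Type u}

/-- The oriented edge `(x, y)` as an element of the real edge space: the space of oriented edges
with `(x, y) = -(y, x)` is realised as antisymmetric functions on ordered pairs of vertices. -/
noncomputable def orientedEdge (x y : W) : (W × W) →₀ ℝ :=
  Finsupp.single (x, y) 1 - Finsupp.single (y, x) 1

/-- The element `(x₁, x₂) + (x₂, x₃) + ⋯` of the edge space given by a walk `x₁, x₂, x₃, …`. -/
noncomputable def walkChain {G : SimpleGraph W} {x y : W} (p : G.Walk x y) : (W × W) →₀ ℝ :=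
  (p.darts.map fun e => orientedEdge e.fst e.snd).sum

/-- `Z_R(G)`: the span of the cycles of length at most `R`. -/
noncomputable def shortCycleSpace (G : SimpleGraph W) (R : ℕ) : Submodule ℝ ((W × W) →₀ ℝ) :=
  Submodule.span ℝ {z | ∃ (x : W) (p : G.Walk x x), p.IsCycle ∧ p.length ≤ R ∧ z = walkChain p}

end CycleSpaces

/-! ### Combinatorial cost -/

section Cost

variable {V : ℕ → Type u}

/-- Two sequences of connected graphs on the same vertex sets induce the same coarse structure:
their path metrics are bi-Lipschitz equivalent with one constant for all `n`. -/
def SameCoarseStructure (X Y : ∀ n, SimpleGraph (V n)) : Prop :=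
  (∀ n, (X n).Connected) ∧ (∀ n, (Y n).Connected) ∧
    ∃ L : ℝ, ∀ n (x y : V n),
      ((X n).dist x y : ℝ) ≤ L * (Y n).dist x y ∧ ((Y n).dist x y : ℝ) ≤ L * (X n).dist x y

/-- `liminf_n |E(Y_n)| / |V(Y_n)|`. -/
noncomputable def liminfEdgeDensity [∀ n, Fintype (V n)] (Y : ∀ n, SimpleGraph (V n)) : ℝ :=
  liminf (fun n => ((Y n).edgeSet.ncard : ℝ) / (Fintype.card (V n) : ℝ)) atTop

/-- The combinatorial cost `c(X)`: the infimum of `liminf_n |E(Y_n)| / |V(X_n)|` over all sequences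
`Y` that induce the same coarse structure as `X`. -/
noncomputable def combinatorialCost [∀ n, Fintype (V n)] (X : ∀ n, SimpleGraph (V n)) : ℝ :=
  sInf {c : ℝ | ∃ Y : ∀ n, SimpleGraph (V n), SameCoarseStructure X Y ∧ c = liminfEdgeDensity Y}

end Cost

/-! ### Uniform Roe algebras and geometric property (T) -/

section Roe

variable {V : ℕ → Type u}

/-- All vertices of all graphs of the sequence have degree at most `d`. -/
def DegreeAtMost (X : ∀ n, SimpleGraph (V n)) (d : ℕ) : Prop :=
  ∀ n (x : V n), ((X n).neighborSet x).ncard ≤ d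

/-- The sequence has uniformly bounded degree. -/
class UniformlyBoundedDegree (X : ∀ n, SimpleGraph (V n)) : Prop where
  exists_bound : ∃ d : ℕ, DegreeAtMost X d

/-- `T` has finite propagation: its entries vanish outside a uniform neighbourhood of the diagonal. -/
def FinitePropagation (X : ∀ n, SimpleGraph (V n)) (T : ∀ n, Matrix (V n) (V n) ℂ) : Prop :=
  ∃ R : ℕ, ∀ n (x y : V n), T n x y ≠ 0 → (X n).edist x y ≤ R

variable [∀ n, Fintype (V n)] [∀ n, DecidableEq (V n)]

/-- The operator norms of the matrices `T n`, acting on the Hilbert spaces `L²(X_n)`, are bounded,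
i.e. `T` lies in the product `∏ B(L²(X_n))`. -/
def IsBoundedSeq (T : ∀ n, Matrix (V n) (V n) ℂ) : Prop :=
  ∃ C : ℝ, ∀ n, ‖Matrix.toEuclideanCLM (𝕜 := ℂ) (T n)‖ ≤ C

/-- The algebraic uniform Roe algebra, inside the product of all matrix algebras. -/
def roeSubalgebra (X : ∀ n, SimpleGraph (V n)) :
    StarSubalgebra ℂ (∀ n, Matrix (V n) (V n) ℂ) where
  carrier := {T | IsBoundedSeq T ∧ FinitePropagation X T}
  mul_mem' := by
    rintro S T ⟨⟨C, hC⟩, R, hR⟩ ⟨⟨D, hD⟩, Q, hQ⟩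
    refine ⟨⟨C * D, fun n => ?_⟩, R + Q, fun n x y h => ?_⟩
    · rw [Pi.mul_apply, map_mul]
      exact (norm_mul_le _ _).trans
        (mul_le_mul (hC n) (hD n) (norm_nonneg _) ((norm_nonneg _).trans (hC n)))
    · rw [Pi.mul_apply, Matrix.mul_apply] at h
      obtain ⟨z, -, hz⟩ := Finset.exists_ne_zero_of_sum_ne_zero h
      have h1 := hR n x z (left_ne_zero_of_mul hz)
      have h2 := hQ n z y (right_ne_zero_of_mul hz)
      push_cast
      exact (X n).edist_triangle.trans (add_le_add h1 h2)
  add_mem' := by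
    rintro S T ⟨⟨C, hC⟩, R, hR⟩ ⟨⟨D, hD⟩, Q, hQ⟩
    refine ⟨⟨C + D, fun n => ?_⟩, max R Q, fun n x y h => ?_⟩
    · rw [Pi.add_apply, map_add]
      exact (norm_add_le _ _).trans (add_le_add (hC n) (hD n))
    · by_cases hS : S n x y = 0
      · have hT : T n x y ≠ 0 := by
          intro hT
          exact h (by simp [hS, hT])
        exact (hQ n x y hT).trans (by exact_mod_cast le_max_right R Q)
      · exact (hR n x y hS).trans (by exact_mod_cast le_max_left R Q)
  algebraMap_mem' := by
    intro c
    refine ⟨⟨‖c‖, fun n => ?_⟩, 0, fun n x y h => ?_⟩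
    · rw [Pi.algebraMap_apply, AlgHomClass.commutes, Algebra.algebraMap_eq_smul_one]
      refine (norm_smul_le _ _).trans ?_
      exact mul_le_of_le_one_right (norm_nonneg c) ContinuousLinearMap.norm_id_le
    · have hxy : x = y := by
        by_contra hxy
        exact h (by simp [Pi.algebraMap_apply, Matrix.algebraMap_matrix_apply, hxy])
      simp [hxy]
  star_mem' := by
    rintro T ⟨⟨C, hC⟩, R, hR⟩
    refine ⟨⟨C, fun n => ?_⟩, R, fun n x y h => ?_⟩
    · rw [Pi.star_apply, map_star, ContinuousLinearMap.star_eq_adjoint,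
        LinearIsometryEquiv.norm_map]
      exact hC n
    · rw [SimpleGraph.edist_comm]
      refine hR n y x fun h0 => h ?_
      simp [Matrix.star_apply, h0]

/-- The algebraic uniform Roe algebra `ℂ_cs[X]`. It is a type of its own, so that it can be given
the maximal norm. -/
def AlgebraicRoe (X : ∀ n, SimpleGraph (V n)) : Type u := roeSubalgebra X

noncomputable instance (X : ∀ n, SimpleGraph (V n)) : Ring (AlgebraicRoe X) :=
  inferInstanceAs (Ring (roeSubalgebra X))

noncomputable instance (X : ∀ n, SimpleGraph (V n)) : StarRing (AlgebraicRoe X) :=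
  inferInstanceAs (StarRing (roeSubalgebra X))

noncomputable instance (X : ∀ n, SimpleGraph (V n)) : Algebra ℂ (AlgebraicRoe X) :=
  inferInstanceAs (Algebra ℂ (roeSubalgebra X))

/-- A representation of `ℂ_cs[X]`: a complex Hilbert space `H` and a unital `*`-homomorphism from
`ℂ_cs[X]` to the bounded operators on `H`. -/
structure RoeRepresentation (X : ∀ n, SimpleGraph (V n)) where
  H : Type u
  [normedAddCommGroup : NormedAddCommGroup H]
  [innerProductSpace : InnerProductSpace ℂ H]
  [completeSpace : CompleteSpace H]
  hom : AlgebraicRoe X →⋆ₐ[ℂ] (H →L[ℂ] H)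

attribute [instance] RoeRepresentation.normedAddCommGroup RoeRepresentation.innerProductSpace
  RoeRepresentation.completeSpace

/-- The maximal norm `‖T‖_max = sup ‖π(T)‖`, over all representations `π`. -/
noncomputable def maxNorm (X : ∀ n, SimpleGraph (V n)) (T : AlgebraicRoe X) : ℝ :=
  ⨆ π : RoeRepresentation X, ‖π.hom T‖

end Roe

/-! ### Finiteness of the maximal norm in uniformly bounded degree -/

section Finiteness

variable {V : ℕ → Type u}

theorem exists_ball_bound (X : ∀ n, SimpleGraph (V n)) [∀ n, Fintype (V n)]
    [hX : UniformlyBoundedDegree X] (R : ℕ) :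
    ∃ N : ℕ, ∀ n (x : V n), {y | (X n).edist x y ≤ R}.ncard ≤ N := by
  classical
  obtain ⟨d, hd⟩ := hX.exists_bound
  induction R with
  | zero =>
    refine ⟨1, fun n x => ?_⟩
    have : {y | (X n).edist x y ≤ (0 : ℕ)} = {x} := by
      ext y
      simp only [Nat.cast_zero, nonpos_iff_eq_zero, SimpleGraph.edist_eq_zero_iff,
        Set.mem_ofPred_eq, Set.mem_singleton_iff]
      exact eq_comm
    rw [this, Set.ncard_singleton]
  | succ R ih =>
    obtain ⟨N, hN⟩ := ih
    refine ⟨1 + d * N, fun n x => ?_⟩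
    have hsub : {y | (X n).edist x y ≤ (R + 1 : ℕ)} ⊆
        {x} ∪ ⋃ z ∈ ((X n).neighborSet x).toFinset, {y | (X n).edist z y ≤ R} := by
      intro y hy
      have hy' : (X n).edist x y ≤ (R + 1 : ℕ) := hy
      have htop : (X n).edist x y ≠ ⊤ := ne_top_of_le_ne_top (ENat.natCast_ne_top _) hy'
      obtain ⟨p, hp⟩ := SimpleGraph.exists_walk_of_edist_ne_top htop
      rw [← hp] at hy'
      have hlen : p.length ≤ R + 1 := by exact_mod_cast hy'
      cases p with
      | nil => simp
      | cons h q =>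
        right
        rw [SimpleGraph.Walk.length_cons] at hlen
        simp only [Set.mem_iUnion]
        refine ⟨_, by simpa using h, ?_⟩
        refine (SimpleGraph.edist_le q).trans ?_
        exact_mod_cast Nat.le_of_succ_le_succ hlen
    refine (Set.ncard_le_ncard hsub (Set.toFinite _)).trans ?_
    refine (Set.ncard_union_le _ _).trans ?_
    rw [Set.ncard_singleton]
    refine Nat.add_le_add_left ((Finset.set_ncard_biUnion_le _ _).trans ?_) 1
    refine (Finset.sum_le_card_nsmul _ _ N fun z _ => hN n z).trans ?_
    rw [smul_eq_mul, ← Set.ncard_eq_toFinset_card']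
    exact Nat.mul_le_mul_right N (hd n x)

theorem norm_le_sqrt_of_star_mul_add {H : Type*} [NormedAddCommGroup H] [InnerProductSpace ℂ H]
    [CompleteSpace H] (A B : H →L[ℂ] H) (c : ℝ)
    (h : star A * A + star B * B = algebraMap ℂ (H →L[ℂ] H) (c : ℂ)) : ‖A‖ ≤ √c := by
  refine A.opNorm_le_bound (Real.sqrt_nonneg c) fun x => ?_
  have key : ∀ D : H →L[ℂ] H, inner ℂ x ((star D * D) x) = ((‖D x‖ ^ 2 : ℝ) : ℂ) := by
    intro D
    rw [mul_apply_eq_comp, ContinuousLinearMap.star_eq_adjoint,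
      ContinuousLinearMap.adjoint_inner_right, inner_self_eq_norm_sq_to_K]
    simp
  have hx := congrArg (fun D : H →L[ℂ] H => inner ℂ x (D x)) h
  simp only [add_apply, inner_add_right, key,
    Algebra.algebraMap_eq_smul_one, smul_apply,
    one_apply_eq_self, inner_smul_right, inner_self_eq_norm_sq_to_K] at hx
  have hx' : ‖A x‖ ^ 2 + ‖B x‖ ^ 2 = c * ‖x‖ ^ 2 := by
    have hx2 := congrArg Complex.re hx
    simpa [← Complex.ofReal_pow] using hx2
  have h1 : ‖A x‖ ^ 2 ≤ c * ‖x‖ ^ 2 := by nlinarith [sq_nonneg ‖B x‖]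
  rw [← Real.sqrt_sq (norm_nonneg x), ← Real.sqrt_mul' c (sq_nonneg ‖x‖)]
  exact Real.le_sqrt_of_sq_le h1

theorem exists_diagonal_complement {W : Type*} [Fintype W] [DecidableEq W] (A : Matrix W W ℂ)
    (hrow : ∀ x y z, A x y ≠ 0 → A x z ≠ 0 → y = z) (c : ℝ)
    (hcol : ∀ y, ∑ x, ‖A x y‖ ^ 2 ≤ c) :
    ∃ s : W → ℂ, star A * A + star (Matrix.diagonal s) * Matrix.diagonal s =
      algebraMap ℂ (Matrix W W ℂ) (c : ℂ) := by
  refine ⟨fun y => ((√(c - ∑ x, ‖A x y‖ ^ 2) : ℝ) : ℂ), ?_⟩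
  ext y z
  rw [Matrix.star_eq_conjTranspose, Matrix.star_eq_conjTranspose, Matrix.diagonal_conjTranspose,
    Matrix.diagonal_mul_diagonal, Matrix.add_apply, Matrix.mul_apply,
    Matrix.algebraMap_matrix_apply]
  by_cases hyz : y = z
  · subst hyz
    simp only [Matrix.diagonal_apply_eq, Matrix.conjTranspose_apply, if_true, Pi.star_apply]
    have h1 : ∀ x, star (A x y) * A x y = ((‖A x y‖ ^ 2 : ℝ) : ℂ) := by
      intro x
      rw [Complex.star_def, Complex.conj_mul']
      simp
    rw [Finset.sum_congr rfl fun x _ => h1 x, Complex.star_def, Complex.conj_ofReal,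
      ← Complex.ofReal_mul, Real.mul_self_sqrt (sub_nonneg.2 (hcol y)), ← Complex.ofReal_sum,
      ← Complex.ofReal_add]
    simp
  · rw [Matrix.diagonal_apply_ne _ hyz, if_neg hyz, add_zero]
    refine Finset.sum_eq_zero fun x _ => ?_
    rw [Matrix.conjTranspose_apply]
    by_contra h
    have h1 : A x y ≠ 0 := fun h0 => h (by simp [h0])
    exact hyz (hrow x y z h1 (right_ne_zero_of_mul h))

variable [∀ n, Fintype (V n)] [∀ n, DecidableEq (V n)]

/-- Entries of finite-propagation matrices in a bounded degree sequence can be sorted into finitely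
many matrices with at most one entry in each row. -/
theorem exists_row_decomposition (X : ∀ n, SimpleGraph (V n)) [UniformlyBoundedDegree X]
    (T : ∀ n, Matrix (V n) (V n) ℂ) (hT : FinitePropagation X T) (M : ℝ)
    (hM : ∀ n x y, ‖T n x y‖ ≤ M) :
    ∃ (N : ℕ) (c : ℝ) (A B : ℕ → ∀ n, Matrix (V n) (V n) ℂ),
      T = ∑ k ∈ Finset.range N, A k ∧
      ∀ k, FinitePropagation X (A k) ∧ FinitePropagation X (B k) ∧
        star (A k) * A k + star (B k) * B k =
          algebraMap ℂ (∀ n, Matrix (V n) (V n) ℂ) (c : ℂ) := by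
  classical
  obtain ⟨R, hR⟩ := hT
  obtain ⟨N, hN⟩ := exists_ball_bound X R
  let b : ∀ n, V n → Finset (V n) := fun n x => {y | (X n).edist x y ≤ R}.toFinset
  have hb : ∀ n x, (b n x).card ≤ N := fun n x => by
    rw [← Set.ncard_eq_toFinset_card']
    exact hN n x
  have hmem : ∀ n x y, T n x y ≠ 0 → y ∈ b n x := fun n x y h => by
    simpa [b] using hR n x y h
  let idx : ∀ n, V n → V n → ℕ := fun n x y =>
    if h : y ∈ b n x then ((b n x).equivFin ⟨y, h⟩ : ℕ) else 0
  have hidx : ∀ n x y, y ∈ b n x → idx n x y < N := fun n x y h => by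
    simp only [idx, dif_pos h]
    exact (Fin.is_lt _).trans_le (hb n x)
  have hinj : ∀ n x y z, y ∈ b n x → z ∈ b n x → idx n x y = idx n x z → y = z := by
    intro n x y z hy hz h
    simp only [idx, dif_pos hy, dif_pos hz] at h
    simpa using (b n x).equivFin.injective (Fin.ext h)
  let A : ℕ → ∀ n, Matrix (V n) (V n) ℂ := fun k n =>
    Matrix.of fun x y => if idx n x y = k then T n x y else 0
  have hA : ∀ k n x y, A k n x y = if idx n x y = k then T n x y else 0 := fun _ _ _ _ => rfl
  have hAT : ∀ k n x y, A k n x y ≠ 0 → idx n x y = k ∧ T n x y ≠ 0 := by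
    intro k n x y h
    rw [hA] at h
    by_cases hk : idx n x y = k
    · rw [if_pos hk] at h
      exact ⟨hk, h⟩
    · rw [if_neg hk] at h
      exact absurd rfl h
  have hAM : ∀ k n x y, ‖A k n x y‖ ≤ ‖T n x y‖ := by
    intro k n x y
    rw [hA]
    split_ifs <;> simp
  have hcol : ∀ k n y, ∑ x, ‖A k n x y‖ ^ 2 ≤ N * M ^ 2 := by
    intro k n y
    have h1 : ∑ x, ‖A k n x y‖ ^ 2 = ∑ x ∈ b n y, ‖A k n x y‖ ^ 2 := by
      refine (Finset.sum_subset (Finset.subset_univ _) fun x _ hx => ?_).symm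
      by_contra h
      have h0 : A k n x y ≠ 0 := fun h0 => h (by simp [h0])
      have h2 := hR n x y (hAT k n x y h0).2
      rw [SimpleGraph.edist_comm] at h2
      exact hx (by simpa [b] using h2)
    rw [h1]
    refine (Finset.sum_le_card_nsmul _ _ (M ^ 2) fun x _ => ?_).trans ?_
    · exact pow_le_pow_left₀ (norm_nonneg _) ((hAM k n x y).trans (hM n x y)) 2
    · rw [nsmul_eq_mul]
      exact mul_le_mul_of_nonneg_right (by exact_mod_cast hb n y) (sq_nonneg M)
  have hrow : ∀ k n x y z, A k n x y ≠ 0 → A k n x z ≠ 0 → y = z := by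
    intro k n x y z hy hz
    obtain ⟨hy1, hy2⟩ := hAT k n x y hy
    obtain ⟨hz1, hz2⟩ := hAT k n x z hz
    exact hinj n x y z (hmem n x y hy2) (hmem n x z hz2) (hy1.trans hz1.symm)
  choose s hs using fun k n => exists_diagonal_complement (A k n) (hrow k n) _ (hcol k n)
  refine ⟨N, N * M ^ 2, A, fun k n => Matrix.diagonal (s k n), ?_, fun k => ⟨?_, ?_, ?_⟩⟩
  · funext n
    ext x y
    rw [Finset.sum_apply, Matrix.sum_apply]
    by_cases h : T n x y = 0
    · simp [hA, h]
    · simp only [hA]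
      rw [Finset.sum_ite_eq, if_pos (Finset.mem_range.2 (hidx n x y (hmem n x y h)))]
  · exact ⟨R, fun n x y h => hR n x y (hAT k n x y h).2⟩
  · refine ⟨0, fun n x y h => ?_⟩
    have hxy : x = y := by
      by_contra hxy
      exact h (Matrix.diagonal_apply_ne _ hxy)
    simp [hxy]
  · funext n
    exact hs k n

theorem isBoundedSeq_of_star_mul_add (A B : ∀ n, Matrix (V n) (V n) ℂ) (c : ℝ)
    (h : star A * A + star B * B = algebraMap ℂ (∀ n, Matrix (V n) (V n) ℂ) (c : ℂ)) :
    IsBoundedSeq A := by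
  refine ⟨√c, fun n => norm_le_sqrt_of_star_mul_add _
    (Matrix.toEuclideanCLM (𝕜 := ℂ) (B n)) c ?_⟩
  have hn := congrArg (Matrix.toEuclideanCLM (𝕜 := ℂ)) (congrFun h n)
  simpa only [Pi.add_apply, Pi.mul_apply, Pi.star_apply, map_add, map_mul, map_star,
    Pi.algebraMap_apply, AlgHomClass.commutes] using hn

/-- In a bounded degree sequence, matrices of finite propagation with bounded entries belong to the
algebraic uniform Roe algebra. -/
theorem mem_roeSubalgebra_of_entries (X : ∀ n, SimpleGraph (V n)) [UniformlyBoundedDegree X]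
    (T : ∀ n, Matrix (V n) (V n) ℂ) (hT : FinitePropagation X T) (M : ℝ)
    (hM : ∀ n x y, ‖T n x y‖ ≤ M) : T ∈ roeSubalgebra X := by
  obtain ⟨N, c, A, B, hsum, hAB⟩ := exists_row_decomposition X T hT M hM
  rw [hsum]
  exact sum_mem fun k _ => ⟨isBoundedSeq_of_star_mul_add _ _ c (hAB k).2.2, (hAB k).1⟩

theorem bddAbove_representation_norms (X : ∀ n, SimpleGraph (V n)) [UniformlyBoundedDegree X]
    (T : AlgebraicRoe X) :
    BddAbove (Set.range fun π : RoeRepresentation X => ‖π.hom T‖) := by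
  obtain ⟨T, ⟨C, hC⟩, hT⟩ := T
  have hM : ∀ n x y, ‖T n x y‖ ≤ C := by
    intro n x y
    have h1 := (Matrix.toEuclideanCLM (𝕜 := ℂ) (T n)).le_opNorm (EuclideanSpace.single y 1)
    rw [PiLp.norm_single, norm_one, mul_one] at h1
    have h2 := PiLp.norm_apply_le
      (Matrix.toEuclideanCLM (𝕜 := ℂ) (T n) (EuclideanSpace.single y 1)) x
    have h3 : Matrix.toEuclideanCLM (𝕜 := ℂ) (T n) (EuclideanSpace.single y 1) x = T n x y := by
      rw [Matrix.ofLp_toEuclideanCLM]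
      simp
    rw [h3] at h2
    exact h2.trans (h1.trans (hC n))
  obtain ⟨N, c, A, B, hsum, hAB⟩ := exists_row_decomposition X T hT C hM
  let a : ℕ → AlgebraicRoe X := fun k =>
    ⟨A k, isBoundedSeq_of_star_mul_add _ _ c (hAB k).2.2, (hAB k).1⟩
  let b : ℕ → AlgebraicRoe X := fun k =>
    ⟨B k, isBoundedSeq_of_star_mul_add _ _ c ((add_comm _ _).trans (hAB k).2.2), (hAB k).2.1⟩
  have hab : ∀ k, star (a k) * a k + star (b k) * b k = algebraMap ℂ (AlgebraicRoe X) (c : ℂ) :=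
    fun k => Subtype.ext (hAB k).2.2
  have hTa : (⟨T, ⟨C, hC⟩, hT⟩ : AlgebraicRoe X) = ∑ k ∈ Finset.range N, a k := by
    refine Subtype.ext (hsum.trans ?_)
    exact (map_sum (roeSubalgebra X).subtype (fun k => (a k : roeSubalgebra X)) _).symm
  refine ⟨∑ k ∈ Finset.range N, √c, ?_⟩
  rintro _ ⟨π, rfl⟩
  simp only
  rw [hTa, map_sum]
  refine norm_sum_le_of_le _ fun k _ => norm_le_sqrt_of_star_mul_add _ (π.hom (b k)) c ?_
  rw [← map_star, ← map_star, ← map_mul, ← map_mul, ← map_add, hab k, AlgHomClass.commutes]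

end Finiteness

/-! ### The maximal uniform Roe algebra and geometric property (T) -/

section GeometricT

variable {V : ℕ → Type u} [∀ n, Fintype (V n)] [∀ n, DecidableEq (V n)]

theorem representation_norm_le_maxNorm (X : ∀ n, SimpleGraph (V n)) [UniformlyBoundedDegree X]
    (π : RoeRepresentation X) (T : AlgebraicRoe X) : ‖π.hom T‖ ≤ maxNorm X T :=
  le_ciSup (bddAbove_representation_norms X T) π

theorem maxNorm_nonneg (X : ∀ n, SimpleGraph (V n)) (T : AlgebraicRoe X) : 0 ≤ maxNorm X T :=
  Real.iSup_nonneg fun _ => norm_nonneg _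

/-- The maximal norm as a seminorm on the additive group of `ℂ_cs[X]`. -/
noncomputable def maxAddGroupSeminorm (X : ∀ n, SimpleGraph (V n)) [UniformlyBoundedDegree X] :
    AddGroupSeminorm (AlgebraicRoe X) where
  toFun := maxNorm X
  map_zero' := by simp [maxNorm]
  add_le' S T := by
    refine Real.iSup_le (fun π => ?_) (add_nonneg (maxNorm_nonneg X S) (maxNorm_nonneg X T))
    rw [map_add]
    exact (norm_add_le _ _).trans (add_le_add (representation_norm_le_maxNorm X π S)
      (representation_norm_le_maxNorm X π T))
  neg' T := by simp [maxNorm]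

/-- `ℂ_cs[X]` with the maximal norm, for a sequence of uniformly bounded degree. -/
noncomputable instance (X : ∀ n, SimpleGraph (V n)) [UniformlyBoundedDegree X] :
    SeminormedRing (AlgebraicRoe X) where
  toRing := inferInstance
  toNorm := (maxAddGroupSeminorm X).toSeminormedAddCommGroup.toNorm
  toPseudoMetricSpace := (maxAddGroupSeminorm X).toSeminormedAddCommGroup.toPseudoMetricSpace
  dist_eq := (maxAddGroupSeminorm X).toSeminormedAddCommGroup.dist_eq
  norm_mul_le S T := by
    change maxNorm X (S * T) ≤ maxNorm X S * maxNorm X T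
    refine Real.iSup_le (fun π => ?_) (mul_nonneg (maxNorm_nonneg X S) (maxNorm_nonneg X T))
    rw [map_mul]
    exact (norm_mul_le _ _).trans (mul_le_mul (representation_norm_le_maxNorm X π S)
      (representation_norm_le_maxNorm X π T) (norm_nonneg _) (maxNorm_nonneg X S))

noncomputable instance (X : ∀ n, SimpleGraph (V n)) [UniformlyBoundedDegree X] :
    NormedAlgebra ℂ (AlgebraicRoe X) where
  norm_smul_le c T := by
    change maxNorm X (c • T) ≤ ‖c‖ * maxNorm X T
    refine Real.iSup_le (fun π => ?_) (mul_nonneg (norm_nonneg c) (maxNorm_nonneg X T))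
    rw [map_smul, norm_smul]
    exact mul_le_mul_of_nonneg_left (representation_norm_le_maxNorm X π T) (norm_nonneg c)

/-- The maximal uniform Roe algebra `C*_max(X)`: the completion of `ℂ_cs[X]` in the maximal norm. -/
abbrev MaxRoe (X : ∀ n, SimpleGraph (V n)) [UniformlyBoundedDegree X] : Type u :=
  UniformSpace.Completion (AlgebraicRoe X)

open Classical in
/-- The Laplacian `Δ_X = ⨁ Δ_{X_n}` as an element of `ℂ_cs[X]`. -/
noncomputable def roeLaplacian (X : ∀ n, SimpleGraph (V n)) [hX : UniformlyBoundedDegree X] :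
    AlgebraicRoe X :=
  ⟨fun n => (X n).lapMatrix ℂ, by
    obtain ⟨d, hd⟩ := hX.exists_bound
    refine mem_roeSubalgebra_of_entries X _ ⟨1, fun n x y h => ?_⟩ (d + 1) fun n x y => ?_
    · rw [Nat.cast_one, SimpleGraph.edist_le_one_iff_adj_or_eq]
      by_contra! hxy
      exact h (by simp [SimpleGraph.lapMatrix, SimpleGraph.degMatrix, hxy.1, hxy.2])
    · have hdeg : ((X n).degree x : ℝ) ≤ d := by
        have := hd n x
        rw [Set.ncard_eq_toFinset_card'] at this
        exact_mod_cast this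
      have hd0 : (0 : ℝ) ≤ d := Nat.cast_nonneg d
      by_cases hxy : x = y
      · subst hxy
        simp only [SimpleGraph.lapMatrix, SimpleGraph.degMatrix, Matrix.sub_apply,
          Matrix.diagonal_apply_eq, SimpleGraph.adjMatrix_apply, SimpleGraph.irrefl, if_false,
          sub_zero, Complex.norm_natCast]
        linarith
      · simp only [SimpleGraph.lapMatrix, SimpleGraph.degMatrix, Matrix.sub_apply,
          Matrix.diagonal_apply_ne _ hxy, SimpleGraph.adjMatrix_apply, zero_sub, norm_neg]
        split_ifs
        · rw [norm_one]
          linarith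
        · rw [norm_zero]
          linarith⟩

/-- Geometric property (T) for a sequence of finite graphs: the graphs are connected, the number of
vertices goes to infinity, the degrees are uniformly bounded, and the spectrum of the Laplacian in
the maximal uniform Roe algebra is contained in `{0} ∪ [γ, ∞)` for some `γ > 0`. -/
def GeometricPropertyT (X : ∀ n, SimpleGraph (V n)) : Prop :=
  (∀ n, (X n).Connected) ∧ Tendsto (fun n => Fintype.card (V n)) atTop atTop ∧
    ∃ _ : UniformlyBoundedDegree X, ∃ γ : ℝ, 0 < γ ∧
      spectrum ℂ ((roeLaplacian X : AlgebraicRoe X) : MaxRoe X) ⊆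
        {0} ∪ Complex.ofReal '' Set.Ici γ

end GeometricT

/-!
Call an edge of `G` a `k`-detour edge if its ends are joined by a walk of length at most `k` that
avoids it; these are the edges on cycles of length at most `k + 1`.

A set of edges, each of which has a short detour avoiding the whole set, can be removed without
changing the coarse structure, and a greedy argument finds such a set that contains a fixed
proportion of all `k`-detour edges. Since `Z_R(G)` is supported on the `(R - 1)`-detour edges, this
proves (i). It also reduces (ii) to showing that, under geometric property (T), every `Y` with the
same coarse structure as `X` has `k`-detour edges of positive density for some `k`.

Suppose not. Then, along an ultrafilter `U` on the indices, almost all vertices of `Y_n` are centres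
of large balls which are trees, and on a tree the kernel `t ^ d(x, y)` is positive semidefinite.
Hence `f T = lim_U |V_n|⁻¹ ∑ (T_n)_{xy} t ^ d(x, y)`, with `d` the distance of `Y_n`, is a positive
functional on `ℂ_cs[X]`, and its GNS representation is bounded by `C*_max(X)`. As `t → 1`,
`f Δ → 0`, so that by the spectral gap the cyclic vector is close to the kernel of `Δ`. On this
kernel every element of `ℂ_cs[X]` with row sums `1` acts as the identity, in particular the
projection `A` that averages over cells of bounded diameter. But for fixed `t < 1` one has
`f A → 0` as the cells grow, a contradiction.
-/

/-! ### The GNS construction for `*`-algebras -/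

section GNS

open UniformSpace ContinuousLinearMap

/-- A positive functional on a `*`-algebra for which left multiplications are bounded. -/
structure BoundedPositiveFunctional (A : Type*) [Ring A] [StarRing A] [Algebra ℂ A] where
  toLin : A →ₗ[ℂ] ℂ
  map_star : ∀ a, toLin (star a) = star (toLin a)
  nonneg : ∀ a, 0 ≤ (toLin (star a * a)).re
  bounded : ∀ a, ∃ C : ℝ, 0 ≤ C ∧
    ∀ b, (toLin (star (a * b) * (a * b))).re ≤ C ^ 2 * (toLin (star b * b)).re

namespace BoundedPositiveFunctional

variable {A : Type*} [Ring A] [StarRing A] [Algebra ℂ A]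

/-- The algebra, as the pre-Hilbert space of the functional `f`. -/
def PreGNS (_f : BoundedPositiveFunctional A) : Type _ := A

variable (f : BoundedPositiveFunctional A)

instance : AddCommGroup f.PreGNS := inferInstanceAs (AddCommGroup A)
instance : Module ℂ f.PreGNS := inferInstanceAs (Module ℂ A)

/-- The identity map from the algebra to its pre-Hilbert space. -/
def toPreGNS : A ≃ₗ[ℂ] f.PreGNS := LinearEquiv.refl ℂ _

variable [StarModule ℂ A]

/-- The semi-inner product `⟨a, b⟩ = f (a⋆ b)`. -/
noncomputable abbrev preCore : PreInnerProductSpace.Core ℂ f.PreGNS where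
  inner a b := f.toLin (star (f.toPreGNS.symm a) * f.toPreGNS.symm b)
  conj_inner_symm a b := by
    rw [← Complex.star_def, ← f.map_star, star_mul, star_star]
  re_inner_nonneg a := f.nonneg _
  add_left _ _ _ := by rw [map_add, star_add, add_mul, map_add]
  smul_left a b c := by simp

noncomputable instance : SeminormedAddCommGroup f.PreGNS :=
  InnerProductSpace.Core.toSeminormedAddCommGroup (c := f.preCore)
noncomputable instance : InnerProductSpace ℂ f.PreGNS :=
  InnerProductSpace.ofCore f.preCore

theorem inner_toPreGNS (a b : A) :
    inner ℂ (f.toPreGNS a) (f.toPreGNS b) = f.toLin (star a * b) := rfl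

theorem norm_toPreGNS_sq (a : A) : ‖f.toPreGNS a‖ ^ 2 = (f.toLin (star a * a)).re := by
  rw [← inner_toPreGNS, ← inner_self_eq_norm_sq (𝕜 := ℂ)]
  rfl

/-- Left multiplication on the pre-Hilbert space. -/
noncomputable def leftMul (a : A) : f.PreGNS →L[ℂ] f.PreGNS :=
  LinearMap.mkContinuous
    (f.toPreGNS.toLinearMap ∘ₗ LinearMap.mulLeft ℂ a ∘ₗ f.toPreGNS.symm.toLinearMap)
    (f.bounded a).choose fun x => by
      obtain ⟨h0, h⟩ := (f.bounded a).choose_spec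
      have hx := h (f.toPreGNS.symm x)
      rw [← norm_toPreGNS_sq, ← norm_toPreGNS_sq, ← mul_pow] at hx
      exact (abs_le_of_sq_le_sq' hx (by positivity)).2

@[simp]
theorem leftMul_apply (a b : A) : f.leftMul a (f.toPreGNS b) = f.toPreGNS (a * b) := rfl

theorem completion_induction {p : Completion f.PreGNS → Prop} (hp : IsClosed {x | p x})
    (h : ∀ a : A, p (f.toPreGNS a : f.PreGNS)) (x : Completion f.PreGNS) : p x :=
  Completion.induction_on x hp fun a => h (f.toPreGNS.symm a)

/-- The GNS representation. -/
noncomputable def gns : A →⋆ₐ[ℂ] (Completion f.PreGNS →L[ℂ] Completion f.PreGNS) where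
  toFun a := (f.leftMul a).completion
  map_one' := by
    ext x
    induction x using f.completion_induction with
    | hp => apply isClosed_eq <;> fun_prop
    | h a => simp
  map_mul' a b := by
    ext x
    induction x using f.completion_induction with
    | hp => apply isClosed_eq <;> fun_prop
    | h c => simp [mul_assoc]
  map_zero' := by
    ext x
    induction x using f.completion_induction with
    | hp => apply isClosed_eq <;> fun_prop
    | h c => simp [Completion.coe_zero]
  map_add' a b := by
    ext x
    induction x using f.completion_induction with
    | hp => apply isClosed_eq <;> fun_prop
    | h c => simp [add_mul, Completion.coe_add]
  commutes' r := by
    ext x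
    induction x using f.completion_induction with
    | hp => apply isClosed_eq <;> fun_prop
    | h c => simp [Algebra.algebraMap_eq_smul_one, Completion.coe_smul]
  map_star' a := by
    refine (eq_adjoint_iff _ _).mpr fun x y => ?_
    induction x using f.completion_induction with
    | hp => apply isClosed_eq <;> fun_prop
    | h b =>
      induction y using f.completion_induction with
      | hp => apply isClosed_eq <;> fun_prop
      | h c => simp [inner_toPreGNS, mul_assoc]

theorem inner_gns_apply (a : A) :
    inner ℂ ((f.toPreGNS 1 : f.PreGNS) : Completion f.PreGNS) (f.gns a (f.toPreGNS 1 : f.PreGNS)) =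
      f.toLin a := by
  change inner ℂ _ ((f.leftMul a).completion _) = _
  simp [inner_toPreGNS]

end BoundedPositiveFunctional

end GNS

/-! ### Spectral gaps -/

section SpectralGap

theorem exists_isStarProjection_of_spectrum_subset {A : Type*} [CStarAlgebra A] [PartialOrder A]
    [StarOrderedRing A] {a : A} (ha : IsSelfAdjoint a) {γ : ℝ} (hγ : 0 < γ)
    (hspec : spectrum ℝ a ⊆ {0} ∪ Set.Ici γ) :
    ∃ p : A, IsStarProjection p ∧ a * p = 0 ∧ γ • (1 - p) ≤ a := by
  -- a continuous function that is the indicator function of `0` on the spectrum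
  let g : ℝ → ℝ := fun x => max (1 - x / γ) 0
  have hg : Continuous g := by fun_prop
  have hg_eq : ∀ x ∈ spectrum ℝ a, x = 0 ∧ g x = 1 ∨ γ ≤ x ∧ g x = 0 := by
    intro x hx
    rcases hspec hx with rfl | hx
    · exact Or.inl ⟨rfl, by simp [g]⟩
    · have : 1 ≤ x / γ := (one_le_div hγ).2 hx
      exact Or.inr ⟨hx, by simp [g, this]⟩
  have hmul : cfc g a * cfc g a = cfc g a := by
    rw [← cfc_mul g g a]
    exact cfc_congr fun x hx => by rcases hg_eq x hx with ⟨-, h⟩ | ⟨-, h⟩ <;> simp [h]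
  refine ⟨cfc g a, ⟨hmul, cfc_predicate g a⟩, ?_, ?_⟩
  · calc a * cfc g a = cfc (fun x => x * g x) a := by rw [cfc_mul (fun x => x) g a, cfc_id' ℝ a]
      _ = cfc (fun _ => 0) a :=
        cfc_congr fun x hx => by rcases hg_eq x hx with ⟨h, -⟩ | ⟨-, h⟩ <;> simp [h]
      _ = 0 := cfc_const_zero ℝ a
  · calc γ • (1 - cfc g a) = cfc (fun x => γ * (1 - g x)) a := by
          rw [cfc_const_mul γ (fun x => 1 - g x) a, cfc_sub (fun _ => 1) g a, cfc_const_one ℝ a]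
      _ ≤ cfc (fun x => x) a :=
        cfc_mono fun x hx => by rcases hg_eq x hx with ⟨rfl, h⟩ | ⟨hγx, h⟩ <;> simp [*]
      _ = a := cfc_id' ℝ a

variable {H : Type*} [NormedAddCommGroup H] [InnerProductSpace ℂ H] [CompleteSpace H]

theorem re_inner_apply_of_isStarProjection {P : H →L[ℂ] H} (hP : IsStarProjection P) (v : H) :
    (inner ℂ v (P v)).re = ‖P v‖ ^ 2 := calc
  _ = (inner ℂ v ((star P * P) v)).re := by
    rw [hP.isSelfAdjoint.star_eq, hP.isIdempotentElem.eq]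
  _ = ‖P v‖ ^ 2 := (P.apply_norm_sq_eq_inner_adjoint_right v).symm

variable {D : H →L[ℂ] H} (hD : IsSelfAdjoint D) {γ : ℝ} (hγ : 0 < γ)
  (hspec : spectrum ℂ D ⊆ {0} ∪ Complex.ofReal '' Set.Ici γ)
include hD hγ hspec

theorem exists_apply_eq_zero_and_norm_sub_sq_le (v : H) :
    ∃ w : H, D w = 0 ∧ γ * ‖v - w‖ ^ 2 ≤ (inner ℂ v (D v)).re := by
  have hspec' : spectrum ℝ D ⊆ {0} ∪ Set.Ici γ := by
    intro x hx
    simpa using hspec ((spectrum.algebraMap_mem_iff ℂ).2 hx)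
  obtain ⟨P, hP, hDP, hle⟩ := exists_isStarProjection_of_spectrum_subset hD hγ hspec'
  refine ⟨P v, by simpa using DFunLike.congr_fun hDP v, ?_⟩
  have hpos := (ContinuousLinearMap.le_def _ _).1 hle |>.re_inner_nonneg_right v
  have hnorm : (inner ℂ v ((1 - P) v)).re = ‖v - P v‖ ^ 2 :=
    re_inner_apply_of_isStarProjection hP.one_sub v
  rw [← hnorm]
  simpa [inner_sub_right, inner_smul_right_eq_smul] using hpos

theorem mul_norm_sq_le_of_isStarProjection {P : H →L[ℂ] H} (hP : IsStarProjection P)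
    (hPD : ∀ w, D w = 0 → P w = w) (v : H) :
    γ * ‖v‖ ^ 2 ≤ γ * (inner ℂ v (P v)).re + (inner ℂ v (D v)).re := by
  obtain ⟨w, hw, hvw⟩ := exists_apply_eq_zero_and_norm_sub_sq_le hD hγ hspec v
  have hsplit : ‖v‖ ^ 2 = (inner ℂ v (P v)).re + (inner ℂ v ((1 - P) v)).re := by
    rw [← Complex.add_re, ← inner_add_right, ← add_apply, add_sub_cancel, one_apply_eq_self]
    exact (inner_self_eq_norm_sq (𝕜 := ℂ) v).symm
  have hcompl : (inner ℂ v ((1 - P) v)).re ≤ ‖v - w‖ ^ 2 := calc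
    _ = ‖(1 - P) (v - w)‖ ^ 2 := by
      rw [re_inner_apply_of_isStarProjection hP.one_sub, map_sub, sub_apply 1 P w,
        one_apply_eq_self, hPD w hw, sub_self, sub_zero]
    _ ≤ ‖v - w‖ ^ 2 := by
      gcongr
      exact (1 - P).le_of_opNorm_le hP.one_sub.norm_le _ |>.trans_eq (one_mul _)
  calc γ * ‖v‖ ^ 2 ≤ γ * ((inner ℂ v (P v)).re + ‖v - w‖ ^ 2) := by
        rw [hsplit]
        gcongr
    _ ≤ _ := by linarith

end SpectralGap

theorem spectrum_hom_subset_spectrum_coe {V : ℕ → Type u} [∀ n, Fintype (V n)]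
    [∀ n, DecidableEq (V n)] (X : ∀ n, SimpleGraph (V n)) [UniformlyBoundedDegree X]
    (π : RoeRepresentation X) (T : AlgebraicRoe X) :
    spectrum ℂ (π.hom T) ⊆ spectrum ℂ (T : MaxRoe X) := by
  have hcont : Continuous (π.hom : AlgebraicRoe X → (π.H →L[ℂ] π.H)) :=
    AddMonoidHomClass.continuous_of_bound π.hom 1 fun S => by
      rw [one_mul]
      exact representation_norm_le_maxNorm X π S
  let E : MaxRoe X →+* (π.H →L[ℂ] π.H) :=
    UniformSpace.Completion.extensionHom (π.hom : AlgebraicRoe X →+* (π.H →L[ℂ] π.H)) hcont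
  have hE : ∀ S : AlgebraicRoe X, E (S : MaxRoe X) = π.hom S := fun S =>
    UniformSpace.Completion.extensionHom_coe _ hcont S
  intro c hc hunit
  refine spectrum.mem_iff.1 hc ?_
  have h := (spectrum.mem_resolventSet_iff.1 hunit).map E
  rwa [map_sub, hE, UniformSpace.Completion.algebraMap_def, hE, AlgHomClass.commutes] at h

/-! ### Edges with short detours -/

section DetourEdges

theorem exists_independent_subset {α : Type*} (C : α → Finset α) (k : ℕ)
    (F : Finset α) (hC : ∀ e ∈ F, (C e).card ≤ k) :
    ∃ E ⊆ F, (E : Set α).Pairwise (fun e f => f ∉ C e) ∧ F.card ≤ (2 * k + 1) * E.card := by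
  classical
  induction F using Finset.strongInduction with
  | H F ih =>
    rcases F.eq_empty_or_nonempty with rfl | hF
    · exact ⟨∅, by simp⟩
    -- The average in-degree is at most the average out-degree.
    obtain ⟨e, heF, he_in⟩ : ∃ e ∈ F, {f ∈ F | e ∈ C f}.card ≤ k := by
      refine Finset.exists_le_of_sum_le hF ?_
      simp only [Finset.card_filter]
      rw [Finset.sum_comm]
      refine Finset.sum_le_sum fun f hf => ?_
      rw [← Finset.card_filter]
      exact (Finset.card_le_card fun x hx => (Finset.mem_filter.1 hx).2).trans (hC f hf)
    set B := insert e (C e ∪ {f ∈ F | e ∈ C f}) with hB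
    have hB_card : B.card ≤ 2 * k + 1 := by
      have := Finset.card_insert_le e (C e ∪ {f ∈ F | e ∈ C f})
      have := Finset.card_union_le (C e) {f ∈ F | e ∈ C f}
      have := hC e heF
      lia
    have hsub : F \ B ⊆ F := Finset.sdiff_subset
    obtain ⟨E, hEF, hE, hcard⟩ := ih (F \ B)
      (hsub.ssubset_of_mem_notMem heF (by simp [hB])) fun f hf => hC f (hsub hf)
    have hnot : ∀ f ∈ E, f ∈ F ∧ f ≠ e ∧ f ∉ C e ∧ e ∉ C f := by
      intro f hf
      have := hEF hf
      simp only [hB, Finset.mem_sdiff, Finset.mem_insert, Finset.mem_union,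
        Finset.mem_filter] at this
      tauto
    refine ⟨insert e E, Finset.insert_subset heF (hEF.trans hsub), ?_, ?_⟩
    · rw [Finset.coe_insert, Set.pairwise_insert]
      exact ⟨hE, fun f hf _ => ⟨(hnot f hf).2.2.1, (hnot f hf).2.2.2⟩⟩
    · rw [Finset.card_insert_of_notMem fun h => (hnot e h).2.1 rfl, mul_add, mul_one]
      have := Finset.le_card_sdiff B F
      lia

variable {W : Type*} {G : SimpleGraph W} {k : ℕ}

/-- The edges of `G` whose end points are joined by a walk of length at most `k` that avoids them,
in other words the edges that lie on a cycle of length at most `k + 1`. -/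
def detourEdges (G : SimpleGraph W) (k : ℕ) : Set (Sym2 W) :=
  {e | e ∈ G.edgeSet ∧ ∃ (x y : W) (p : G.Walk x y), e = s(x, y) ∧ e ∉ p.edges ∧ p.length ≤ k}

theorem mem_detourEdges_of_isCycle {x : W} {c : G.Walk x x} (hc : c.IsCycle)
    (hlen : c.length ≤ k + 1) {e : G.Dart} (he : e ∈ c.darts) : e.edge ∈ detourEdges G k := by
  obtain ⟨q, r, rfl⟩ := (SimpleGraph.Walk.isSubwalk_toWalk_adj_iff_mem_darts c).2 he
  have hnodup := hc.isTrail.edges_nodup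
  refine ⟨e.edge_mem, e.snd, e.fst, r.append q, Sym2.eq_swap, ?_, ?_⟩
  · simp only [SimpleGraph.Walk.edges_append, SimpleGraph.Adj.toWalk, SimpleGraph.Walk.edges_cons,
      SimpleGraph.Walk.edges_nil, List.append_assoc, List.singleton_append] at hnodup ⊢
    have := (List.nodup_cons.1 (List.nodup_middle.1 hnodup)).1
    rwa [List.mem_append, or_comm, ← List.mem_append] at this
  · simp only [SimpleGraph.Walk.length_append, SimpleGraph.Adj.toWalk,
      SimpleGraph.Walk.length_cons, SimpleGraph.Walk.length_nil] at hlen ⊢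
    lia

theorem exists_isCycle_of_mem_detourEdges {e : Sym2 W} (he : e ∈ detourEdges G k) :
    ∃ (x : W) (c : G.Walk x x), c.IsCycle ∧ c.length ≤ k + 1 := by
  classical
  obtain ⟨hadj, x, y, p, rfl, hp, hlen⟩ := he
  refine ⟨y, .cons (SimpleGraph.Adj.symm hadj) p.bypass, ?_, ?_⟩
  · rw [SimpleGraph.Walk.cons_isCycle_iff, Sym2.eq_swap]
    exact ⟨p.bypass_isPath, fun h => hp (p.edges_bypass_subset_edges h)⟩
  · rw [SimpleGraph.Walk.length_cons]
    exact Nat.succ_le_succ (p.length_bypass_le_length.trans hlen)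

theorem neighborSet_eq_of_isCycle [Finite W] {x y : W} {c : G.Walk x x} (hc : c.IsCycle)
    (hdeg : (G.neighborSet y).ncard ≤ 2) (hy : y ∈ c.support) :
    c.toSubgraph.neighborSet y = G.neighborSet y :=
  Set.eq_of_subset_of_ncard_le (c.toSubgraph.neighborSet_subset y)
    (by rwa [hc.ncard_neighborSet_toSubgraph_eq_two hy])

theorem ncard_edgeSet_le_length_of_isCycle [Finite W] (hG : G.Connected)
    (hdeg : ∀ x, (G.neighborSet x).ncard ≤ 2) {x : W} {c : G.Walk x x} (hc : c.IsCycle) :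
    G.edgeSet.ncard ≤ c.length := by
  classical
  have hnbr : ∀ {y z}, y ∈ c.support → G.Adj y z → c.toSubgraph.Adj y z := fun {y z} hy hyz => by
    have : z ∈ c.toSubgraph.neighborSet y := by
      rwa [neighborSet_eq_of_isCycle hc (hdeg y) hy]
    exact this
  have hsupport : ∀ y, y ∈ c.support := by
    intro y
    by_contra hy
    obtain ⟨p⟩ := hG.preconnected x y
    obtain ⟨e, -, hfst, hsnd⟩ := p.exists_boundary_dart {z | z ∈ c.support} c.start_mem_support hy
    exact hsnd (c.mem_verts_toSubgraph.1 (hnbr hfst e.adj).snd_mem)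
  have hsub : G.edgeSet ⊆ c.edges.toFinset := by
    intro e he
    induction e with
    | h y z => exact List.mem_toFinset.2 (c.mem_edges_toSubgraph.1 (hnbr (hsupport y) he))
  calc G.edgeSet.ncard ≤ c.edges.toFinset.card := by
        exact Set.ncard_coe_finset _ ▸ Set.ncard_le_ncard hsub (Set.toFinite _)
    _ ≤ c.length := c.length_edges ▸ List.toFinset_card_le _

theorem two_le_of_isCycle [Finite W] {d : ℕ} (hdeg : ∀ x, (G.neighborSet x).ncard ≤ d) {x : W}
    {c : G.Walk x x} (hc : c.IsCycle) : 2 ≤ d :=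
  calc 2 = (c.toSubgraph.neighborSet x).ncard :=
        (hc.ncard_neighborSet_toSubgraph_eq_two c.start_mem_support).symm
    _ ≤ (G.neighborSet x).ncard := Set.ncard_le_ncard (c.toSubgraph.neighborSet_subset x)
    _ ≤ d := hdeg x

/-! ### Removing edges with short detours -/

/-- A set of edges, each of which can be replaced by a walk of length at most `k` that avoids the
whole set: the edges that can be removed at once without changing the coarse structure. -/
def IsBypassable (G : SimpleGraph W) (k : ℕ) (E : Set (Sym2 W)) : Prop :=
  ∀ e ∈ E, ∃ (x y : W) (p : G.Walk x y), e = s(x, y) ∧ (∀ f ∈ p.edges, f ∉ E) ∧ p.length ≤ k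

namespace IsBypassable

variable {E : Set (Sym2 W)}

theorem empty : IsBypassable G k ∅ := fun _ he => absurd he (Set.notMem_empty _)

theorem singleton {e : Sym2 W} (he : e ∈ detourEdges G k) : IsBypassable G k {e} := by
  rintro _ rfl
  obtain ⟨-, x, y, p, hxy, hp, hlen⟩ := he
  exact ⟨x, y, p, hxy, fun f hf hfe => hp (hfe ▸ hf), hlen⟩

theorem exists_walk_of_adj (hE : IsBypassable G k E) {x y : W} (hxy : G.Adj x y) :
    ∃ q : (G.deleteEdges E).Walk x y, q.length ≤ k + 1 := by
  by_cases h : s(x, y) ∈ E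
  · obtain ⟨a, b, p, hab, hp, hlen⟩ := hE _ h
    have hq : (p.toDeleteEdges E hp).length ≤ k + 1 := by simpa using hlen.trans k.le_succ
    rcases Sym2.eq_iff.1 hab with ⟨rfl, rfl⟩ | ⟨rfl, rfl⟩
    · exact ⟨_, hq⟩
    · exact ⟨(p.toDeleteEdges E hp).reverse, by rwa [SimpleGraph.Walk.length_reverse]⟩
  · exact ⟨.cons (SimpleGraph.deleteEdges_adj.2 ⟨hxy, h⟩) .nil, by simp⟩

theorem exists_walk (hE : IsBypassable G k E) {x y : W} (p : G.Walk x y) :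
    ∃ q : (G.deleteEdges E).Walk x y, q.length ≤ (k + 1) * p.length := by
  induction p with
  | nil => exact ⟨.nil, by simp⟩
  | cons hadj p ih =>
    obtain ⟨q, hq⟩ := ih
    obtain ⟨r, hr⟩ := hE.exists_walk_of_adj hadj
    refine ⟨r.append q, ?_⟩
    rw [SimpleGraph.Walk.length_append, SimpleGraph.Walk.length_cons, mul_add, mul_one]
    lia

theorem connected_deleteEdges (hE : IsBypassable G k E) (hG : G.Connected) :
    (G.deleteEdges E).Connected := by
  have := hG.nonempty
  refine ⟨fun x y => ?_⟩
  obtain ⟨p⟩ := hG.preconnected x y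
  exact ⟨(hE.exists_walk p).choose⟩

theorem dist_deleteEdges_le (hE : IsBypassable G k E) (hG : G.Connected) (x y : W) :
    (G.deleteEdges E).dist x y ≤ (k + 1) * G.dist x y := by
  obtain ⟨p, hp⟩ := hG.exists_walk_length_eq_dist x y
  obtain ⟨q, hq⟩ := hE.exists_walk p
  exact hp ▸ (SimpleGraph.dist_le q).trans hq

end IsBypassable

theorem exists_isBypassable_subset [Finite W] (G : SimpleGraph W) (k : ℕ) :
    ∃ E ⊆ detourEdges G k, IsBypassable G k E ∧
      (detourEdges G k).ncard ≤ (2 * k + 1) * E.ncard := by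
  classical
  cases nonempty_fintype W
  have hdetour : ∀ e ∈ detourEdges G k, ∃ C : Finset (Sym2 W), C.card ≤ k ∧ e ∉ C ∧
      ∃ (x y : W) (p : G.Walk x y), e = s(x, y) ∧ (∀ f ∈ p.edges, f ∈ C) ∧ p.length ≤ k := by
    rintro e ⟨-, x, y, p, he, hp, hlen⟩
    refine ⟨p.edges.toFinset, ?_, by simpa using hp, x, y, p, he, by simp, hlen⟩
    exact (List.toFinset_card_le _).trans (by rwa [SimpleGraph.Walk.length_edges])
  choose! C hC_card hC_self hC_walk using hdetour
  obtain ⟨E, hEF, hE, hcard⟩ := exists_independent_subset C k (detourEdges G k).toFinset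
    fun e he => hC_card e (Set.mem_toFinset.1 he)
  rw [Set.subset_toFinset] at hEF
  refine ⟨E, hEF, fun e he => ?_, ?_⟩
  · obtain ⟨x, y, p, hxy, hp, hlen⟩ := hC_walk e (hEF he)
    refine ⟨x, y, p, hxy, fun f hf hfE => ?_, hlen⟩
    rcases eq_or_ne e f with rfl | hef
    · exact hC_self e (hEF he) (hp e hf)
    · exact hE he hfE hef (hp f hf)
  · rwa [Set.ncard_eq_toFinset_card', Set.ncard_coe_finset]

theorem exists_isBypassable_subset_of_degree_le [Finite W] (hG : G.Connected) {d : ℕ}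
    (hdeg : ∀ x, (G.neighborSet x).ncard ≤ d) (k : ℕ) :
    ∃ E ⊆ detourEdges G k, IsBypassable G k E ∧ (detourEdges G k).ncard ≤ d ^ k * E.ncard := by
  rcases (detourEdges G k).eq_empty_or_nonempty with hempty | ⟨e, he⟩
  · exact ⟨∅, Set.empty_subset _, .empty, by simp [hempty]⟩
  obtain ⟨x, c, hc, hlen⟩ := exists_isCycle_of_mem_detourEdges he
  rcases (two_le_of_isCycle hdeg hc).eq_or_lt with rfl | hd
  -- For `d = 2` the cycle through `e` is the whole graph.
  · refine ⟨{e}, Set.singleton_subset_iff.2 he, .singleton he, ?_⟩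
    rw [Set.ncard_singleton, mul_one]
    calc (detourEdges G k).ncard ≤ G.edgeSet.ncard := Set.ncard_le_ncard fun e he => he.1
      _ ≤ c.length := ncard_edgeSet_le_length_of_isCycle hG hdeg hc
      _ ≤ k + 1 := hlen
      _ ≤ 2 ^ k := k.lt_two_pow_self
  · obtain ⟨E, hEF, hE, hcard⟩ := exists_isBypassable_subset G k
    refine ⟨E, hEF, hE, hcard.trans (Nat.mul_le_mul_right _ ?_)⟩
    calc 2 * k + 1 = 1 + k * 2 := by ring
      _ ≤ (1 + 2) ^ k := one_add_le_pow_of_two_add_nonneg (Nat.zero_le _) k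
      _ ≤ d ^ k := Nat.pow_le_pow_left hd k

theorem ncard_edgeSet_deleteEdges_add_ncard [Finite W] (G : SimpleGraph W) {E : Set (Sym2 W)}
    (hE : E ⊆ G.edgeSet) : (G.deleteEdges E).edgeSet.ncard + E.ncard = G.edgeSet.ncard := by
  rw [SimpleGraph.edgeSet_deleteEdges]
  exact Set.ncard_sdiff_add_ncard_of_subset hE

end DetourEdges

theorem finrank_shortCycleSpace_le {W : Type u} [Finite W] (G : SimpleGraph W) (R : ℕ) :
    Module.finrank ℝ (shortCycleSpace G R) ≤ (detourEdges G (R - 1)).ncard := by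
  classical
  cases nonempty_fintype W
  let b : Sym2 W → ((W × W) →₀ ℝ) := fun e => orientedEdge e.out.1 e.out.2
  let S : Finset ((W × W) →₀ ℝ) := (detourEdges G (R - 1)).toFinset.image b
  have hsub : shortCycleSpace G R ≤ Submodule.span ℝ (S : Set ((W × W) →₀ ℝ)) := by
    refine Submodule.span_le.2 ?_
    rintro z ⟨x, p, hp, hlen, rfl⟩
    refine list_sum_mem fun z hz => ?_
    obtain ⟨e, he, rfl⟩ := List.mem_map.1 hz
    have hmem : b e.edge ∈ Submodule.span ℝ (S : Set ((W × W) →₀ ℝ)) :=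
      Submodule.subset_span <| Finset.mem_coe.2 <| Finset.mem_image_of_mem b <|
        Set.mem_toFinset.2 (mem_detourEdges_of_isCycle hp (by lia) he)
    have hout : s(e.edge.out.1, e.edge.out.2) = s(e.fst, e.snd) := Quot.out_eq e.edge
    rcases Sym2.eq_iff.1 hout with ⟨hfst, hsnd⟩ | ⟨hfst, hsnd⟩
    · simpa [b, hfst, hsnd] using hmem
    · have : orientedEdge e.fst e.snd = -b e.edge := by
        simp only [b, hfst, hsnd, orientedEdge, neg_sub]
      exact this ▸ Submodule.neg_mem _ hmem
  calc Module.finrank ℝ (shortCycleSpace G R)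
      ≤ Module.finrank ℝ (Submodule.span ℝ (S : Set ((W × W) →₀ ℝ))) :=
        Submodule.finrank_mono hsub
    _ ≤ S.card := finrank_span_finset_le_card S
    _ ≤ (detourEdges G (R - 1)).ncard := by
        rw [Set.ncard_eq_toFinset_card']
        exact Finset.card_image_le

/-! ### Comparison of costs -/

theorem liminf_nonneg_of_nonneg {v : ℕ → ℝ} (hv : ∀ n, 0 ≤ v n) : 0 ≤ liminf v atTop := by
  rw [liminf_eq]
  by_cases h : BddAbove {a | ∀ᶠ n in atTop, a ≤ v n}
  · exact le_csSup h (.of_forall hv)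
  · rw [Real.sSup_of_not_bddAbove h]

theorem liminf_le_liminf_sub {v w : ℕ → ℝ} {B δ : ℝ} (hv : ∀ n, 0 ≤ v n) (hw : ∀ n, 0 ≤ w n)
    (hB : ∀ n, w n ≤ B) (h : ∀ᶠ n in atTop, v n ≤ w n - δ) :
    liminf v atTop ≤ liminf w atTop - δ := by
  have hw_above : IsBoundedUnder (· ≤ ·) atTop w := isBoundedUnder_of ⟨B, hB⟩
  have hsub_above : IsBoundedUnder (· ≤ ·) atTop (fun n => w n - δ) :=
    isBoundedUnder_of ⟨B - δ, fun n => sub_le_sub_right (hB n) δ⟩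
  calc liminf v atTop ≤ liminf (fun n => w n - δ) atTop :=
        liminf_le_liminf h (isBoundedUnder_of ⟨0, hv⟩) hsub_above.isCoboundedUnder_ge
    _ = liminf w atTop - δ := by
        simp only [sub_eq_add_neg]
        exact liminf_add_const atTop w (-δ) hw_above.isCoboundedUnder_ge
          (isBoundedUnder_of ⟨0, hw⟩)

theorem ncard_edgeSet_le_mul_card {W : Type*} [Fintype W] (G : SimpleGraph W) {d : ℕ}
    (hdeg : ∀ x, (G.neighborSet x).ncard ≤ d) : G.edgeSet.ncard ≤ d * Fintype.card W := by
  classical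
  calc G.edgeSet.ncard = G.edgeFinset.card := Set.ncard_eq_toFinset_card' _
    _ ≤ 2 * G.edgeFinset.card := Nat.le_mul_of_pos_left _ two_pos
    _ = ∑ x, G.degree x := G.sum_degrees_eq_twice_card_edges.symm
    _ ≤ ∑ _x : W, d := Finset.sum_le_sum fun x _ => by
        exact (Set.ncard_eq_toFinset_card' _).symm.trans_le (hdeg x)
    _ = d * Fintype.card W := by
        rw [Finset.sum_const, Finset.card_univ, smul_eq_mul, mul_comm]

section Cost

variable {V : ℕ → Type u}

namespace SameCoarseStructure

variable {X Y Z : ∀ n, SimpleGraph (V n)}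

theorem exists_nat (h : SameCoarseStructure X Y) : ∃ L : ℕ, ∀ n (x y : V n),
    (X n).dist x y ≤ L * (Y n).dist x y ∧ (Y n).dist x y ≤ L * (X n).dist x y := by
  obtain ⟨-, -, L, hL⟩ := h
  obtain ⟨M, hM⟩ := exists_nat_ge L
  refine ⟨M, fun n x y => ⟨?_, ?_⟩⟩
  · exact_mod_cast (hL n x y).1.trans (mul_le_mul_of_nonneg_right hM (Nat.cast_nonneg _))
  · exact_mod_cast (hL n x y).2.trans (mul_le_mul_of_nonneg_right hM (Nat.cast_nonneg _))

theorem refl (h : ∀ n, (X n).Connected) : SameCoarseStructure X X :=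
  ⟨h, h, 1, fun n x y => by simp⟩

theorem trans (hXY : SameCoarseStructure X Y) (hYZ : SameCoarseStructure Y Z) :
    SameCoarseStructure X Z := by
  obtain ⟨L, hL⟩ := hXY.exists_nat
  obtain ⟨M, hM⟩ := hYZ.exists_nat
  refine ⟨hXY.1, hYZ.2.1, (L * M : ℕ), fun n x y => ⟨?_, ?_⟩⟩ <;> norm_cast
  · exact mul_assoc L M _ ▸ (hL n x y).1.trans (Nat.mul_le_mul_left L (hM n x y).1)
  · exact mul_comm L M ▸ mul_assoc M L _ ▸
      (hM n x y).2.trans (Nat.mul_le_mul_left M (hL n x y).2)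

theorem deleteEdges {E : ∀ n, Set (Sym2 (V n))} {k : ℕ} (hY : ∀ n, (Y n).Connected)
    (hE : ∀ n, IsBypassable (Y n) k (E n)) :
    SameCoarseStructure Y fun n => (Y n).deleteEdges (E n) := by
  have hconn := fun n => (hE n).connected_deleteEdges (hY n)
  refine ⟨hY, hconn, (k + 1 : ℕ), fun n x y => ⟨?_, ?_⟩⟩ <;> norm_cast
  · have := ((hconn n).preconnected x y).dist_anti ((Y n).deleteEdges_le (E n))
    exact this.trans (Nat.le_mul_of_pos_left _ k.succ_pos)
  · exact (hE n).dist_deleteEdges_le (hY n) x y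

variable [∀ n, Finite (V n)]

theorem exists_ball_bound [UniformlyBoundedDegree X] (h : SameCoarseStructure X Y) (r : ℕ) :
    ∃ N : ℕ, ∀ n (x : V n), {y | (Y n).dist x y ≤ r}.ncard ≤ N := by
  obtain ⟨L, hL⟩ := h.exists_nat
  have := fun n => Fintype.ofFinite (V n)
  obtain ⟨N, hN⟩ := _root_.exists_ball_bound X (L * r)
  refine ⟨N, fun n x => (Set.ncard_le_ncard (fun y hy => ?_) (Set.toFinite _)).trans (hN n x)⟩
  have hdist : (X n).dist x y ≤ L * r := (hL n x y).1.trans (Nat.mul_le_mul_left L hy)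
  rw [Set.mem_ofPred_eq, ← ((h.1 n).preconnected x y).coe_dist_eq_edist]
  exact_mod_cast hdist

theorem exists_degree_bound [UniformlyBoundedDegree X] (h : SameCoarseStructure X Y) :
    ∃ d : ℕ, DegreeAtMost Y d := by
  obtain ⟨N, hN⟩ := h.exists_ball_bound 1
  refine ⟨N, fun n x => (Set.ncard_le_ncard (fun y hy => ?_) (Set.toFinite _)).trans (hN n x)⟩
  exact (SimpleGraph.dist_eq_one_iff_adj.2 hy).le

end SameCoarseStructure

variable [∀ n, Fintype (V n)] {X Y : ∀ n, SimpleGraph (V n)}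

theorem combinatorialCost_le (h : SameCoarseStructure X Y) :
    combinatorialCost X ≤ liminfEdgeDensity Y := by
  refine csInf_le ⟨0, ?_⟩ ⟨Y, h, rfl⟩
  rintro _ ⟨Z, -, rfl⟩
  exact liminf_nonneg_of_nonneg fun n => by positivity

theorem combinatorialCost_le_sub (h : SameCoarseStructure X Y) {d k : ℕ} (hd : DegreeAtMost Y d)
    {ε : ℝ} (hdetour : ∀ᶠ n in atTop,
      ε * (Fintype.card (V n) : ℝ) ≤ ((detourEdges (Y n) k).ncard : ℝ)) :
    combinatorialCost X ≤ liminfEdgeDensity Y - ε / (d : ℝ) ^ k := by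
  have hpos : ∀ n, 0 < (Fintype.card (V n) : ℝ) := fun n => by
    have := (h.1 n).nonempty
    exact_mod_cast Fintype.card_pos
  choose E hsub hbyp hcard using fun n =>
    exists_isBypassable_subset_of_degree_le (h.2.1 n) (hd n) k
  refine (combinatorialCost_le (h.trans (.deleteEdges h.2.1 hbyp))).trans ?_
  refine liminf_le_liminf_sub (B := d) (fun n => by positivity) (fun n => by positivity) ?_ ?_
  · intro n
    rw [div_le_iff₀ (hpos n)]
    exact_mod_cast ncard_edgeSet_le_mul_card (Y n) (hd n)
  · filter_upwards [hdetour] with n hn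
    have hremoved : ε / (d : ℝ) ^ k * Fintype.card (V n) ≤ ((E n).ncard : ℝ) := by
      rw [div_mul_eq_mul_div]
      refine div_le_of_le_mul₀ (by positivity) (by positivity) (hn.trans ?_)
      rw [mul_comm]
      exact_mod_cast hcard n
    have hedges := ncard_edgeSet_deleteEdges_add_ncard (Y n) fun e he => (hsub n he).1
    rw [div_le_iff₀ (hpos n), sub_mul, div_mul_cancel₀ _ (hpos n).ne', ← hedges, Nat.cast_add]
    linarith

theorem combinatorialCost_le_of_shortCycleSpace (hconn : ∀ n, (X n).Connected) {d : ℕ}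
    (hd : DegreeAtMost X d) {R : ℕ} {ε : ℝ}
    (hZ : ∀ n, ε * (Fintype.card (V n) : ℝ) ≤
      (Module.finrank ℝ (shortCycleSpace (X n) R) : ℝ)) :
    combinatorialCost X ≤ liminfEdgeDensity X - ε / (d : ℝ) ^ (R - 1) :=
  combinatorialCost_le_sub (.refl hconn) hd <| .of_forall fun n =>
    (hZ n).trans (by exact_mod_cast finrank_shortCycleSpace_le (X n) R)

end Cost

/-! ### Positivity of `t ^ d(x, y)` on tree-like balls -/

section TreeLike

variable {W : Type*} {G : SimpleGraph W} {z : W} {r : ℕ}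

theorem dist_lt_of_mem_support {x y z : W} {p : G.Walk x z} (hp : p.length = G.dist x z)
    (hy : y ∈ p.support) (hyx : y ≠ x) : G.dist y z < G.dist x z := by
  classical
  have hlen : (p.takeUntil y hy).length + (p.dropUntil y hy).length = p.length := by
    rw [← SimpleGraph.Walk.length_append, SimpleGraph.Walk.take_spec]
  have hpos : (p.takeUntil y hy).length ≠ 0 := fun h =>
    hyx (SimpleGraph.Walk.eq_of_length_eq_zero h).symm
  have := SimpleGraph.dist_le (p.dropUntil y hy)
  lia

theorem mem_detourEdges_of_dist_eq (hG : G.Connected) {x y : W} (hxy : G.Adj x y)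
    (hx : G.dist x z ≤ r) (h : G.dist x z = G.dist y z) : s(x, y) ∈ detourEdges G (2 * r) := by
  obtain ⟨p, hp⟩ := hG.exists_walk_length_eq_dist x z
  obtain ⟨q, hq⟩ := hG.exists_walk_length_eq_dist y z
  refine ⟨hxy, x, y, p.append q.reverse, rfl, ?_, ?_⟩
  · rw [SimpleGraph.Walk.edges_append, List.mem_append, SimpleGraph.Walk.edges_reverse,
      List.mem_reverse]
    rintro (he | he)
    · exact (dist_lt_of_mem_support hp (p.snd_mem_support_of_mem_edges he) hxy.ne').ne h.symm
    · exact (dist_lt_of_mem_support hq (q.fst_mem_support_of_mem_edges he) hxy.ne).ne h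
  · rw [SimpleGraph.Walk.length_append, SimpleGraph.Walk.length_reverse]
    lia

theorem mem_detourEdges_of_dist_add_one_eq (hG : G.Connected) {x y₁ y₂ : W} (hxy₁ : G.Adj x y₁)
    (hxy₂ : G.Adj x y₂) (hne : y₁ ≠ y₂) (hx : G.dist x z ≤ r)
    (h₁ : G.dist y₁ z + 1 = G.dist x z) (h₂ : G.dist y₂ z + 1 = G.dist x z) :
    s(x, y₁) ∈ detourEdges G (2 * r) := by
  obtain ⟨p, hp⟩ := hG.exists_walk_length_eq_dist y₂ z
  obtain ⟨q, hq⟩ := hG.exists_walk_length_eq_dist y₁ z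
  refine ⟨hxy₁, x, y₁, (SimpleGraph.Walk.cons hxy₂ p).append q.reverse, rfl, ?_, ?_⟩
  · rw [SimpleGraph.Walk.edges_append, List.mem_append, SimpleGraph.Walk.edges_reverse,
      List.mem_reverse, SimpleGraph.Walk.edges_cons, List.mem_cons]
    rintro ((he | he) | he)
    · exact hne (Sym2.congr_right.1 he)
    · have := dist_lt_of_mem_support hp (p.fst_mem_support_of_mem_edges he) hxy₂.ne
      lia
    · have := dist_lt_of_mem_support hq (q.fst_mem_support_of_mem_edges he) hxy₁.ne
      lia
  · rw [SimpleGraph.Walk.length_append, SimpleGraph.Walk.length_reverse,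
      SimpleGraph.Walk.length_cons]
    lia

theorem exists_dist_eq_sub_one (hG : G.Connected) (z x : W) :
    ∃ y, G.dist y z = G.dist x z - 1 ∧ (x ≠ z → G.Adj x y) := by
  obtain ⟨p, hp⟩ := hG.exists_walk_length_eq_dist x z
  cases p with
  | nil => exact ⟨z, by simp, fun h => absurd rfl h⟩
  | @cons _ y _ hadj q =>
    refine ⟨y, ?_, fun _ => hadj⟩
    have hle := SimpleGraph.dist_le q
    have htri : G.dist x z ≤ G.dist x y + G.dist y z := hG.dist_triangle
    rw [SimpleGraph.dist_eq_one_iff_adj.2 hadj] at htri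
    rw [SimpleGraph.Walk.length_cons] at hp
    lia

/-- Around `z`, up to distance `r`, the graph is a tree in which `par` sends a vertex to its
neighbour on the way to `z` (and fixes `z`, by truncated subtraction). -/
structure IsTreeLike (G : SimpleGraph W) (z : W) (r : ℕ) (par : W → W) : Prop where
  dist_par : ∀ x, G.dist (par x) z = G.dist x z - 1
  adj_par : ∀ x, x ≠ z → G.Adj x (par x)
  par_or_par : ∀ x y, G.Adj x y → G.dist x z ≤ r → G.dist y z ≤ r → par x = y ∨ par y = x

theorem exists_isTreeLike (hG : G.Connected)
    (h : ∀ x y, G.dist x z ≤ r → s(x, y) ∉ detourEdges G (2 * r)) :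
    ∃ par, IsTreeLike G z r par := by
  choose par hdist hadj using exists_dist_eq_sub_one hG z
  refine ⟨par, hdist, hadj, ?_⟩
  have par_eq : ∀ x y, G.Adj x y → G.dist x z ≤ r → G.dist y z < G.dist x z → par x = y := by
    intro x y hxy hx hlt
    by_contra hne
    have hxz : x ≠ z := by
      rintro rfl
      simp at hlt
    have htri : G.dist x z ≤ G.dist x y + G.dist y z := hG.dist_triangle
    rw [SimpleGraph.dist_eq_one_iff_adj.2 hxy] at htri
    have := hdist x
    exact h x (par x) hx (mem_detourEdges_of_dist_add_one_eq hG (hadj x hxz) hxy hne hx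
      (by lia) (by lia))
  intro x y hxy hx hy
  rcases lt_trichotomy (G.dist x z) (G.dist y z) with hlt | heq | hlt
  · exact .inr (par_eq y x hxy.symm hy hlt)
  · exact absurd (mem_detourEdges_of_dist_eq hG hxy hx heq) (h x y hx)
  · exact .inl (par_eq x y hxy hx hlt)

namespace IsTreeLike

variable {par : W → W}

theorem dist_iterate (h : IsTreeLike G z r par) (i : ℕ) (x : W) :
    G.dist (par^[i] x) z = G.dist x z - i := by
  induction i generalizing x with
  | zero => simp
  | succ i ih =>
    rw [Function.iterate_succ_apply, ih, h.dist_par]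
    lia

theorem par_mem_support (h : IsTreeLike G z r par) {x y : W} {p : G.Walk x y}
    (hp : ∀ v ∈ p.support, G.dist v z ≤ r) (hy : ∀ i, par^[i] y ≠ x) : par x ∈ p.support := by
  -- The walk has to leave the set of descendants of `x`, and it can only do so at `x`.
  obtain ⟨e, he, ⟨i, hi⟩, hsnd⟩ := p.exists_boundary_dart {v | ∃ i, par^[i] v = x} ⟨0, rfl⟩
    fun ⟨i, hi⟩ => hy i hi
  have hfst_mem := p.dart_fst_mem_support_of_mem_darts he
  have hsnd_mem := p.dart_snd_mem_support_of_mem_darts he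
  rcases h.par_or_par _ _ e.adj (hp _ hfst_mem) (hp _ hsnd_mem) with hpar | hpar
  · cases i with
    | zero =>
      obtain rfl : e.fst = x := hi
      exact hpar ▸ hsnd_mem
    | succ i =>
      rw [Function.iterate_succ_apply, hpar] at hi
      exact absurd ⟨i, hi⟩ hsnd
  · exact absurd ⟨i + 1, by rw [Function.iterate_succ_apply, hpar, hi]⟩ hsnd

theorem dist_eq_dist_par_add_one {s : ℕ} (hs : 3 * s ≤ r) (hG : G.Connected)
    (h : IsTreeLike G z r par) {x y : W} (hxy : x ≠ y) (hle : G.dist y z ≤ G.dist x z)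
    (hx : G.dist x z ≤ s) : G.dist x y = G.dist (par x) y + 1 := by
  classical
  have hxz : x ≠ z := by
    rintro rfl
    rw [SimpleGraph.dist_self, Nat.le_zero, hG.dist_eq_zero_iff] at hle
    exact hxy hle.symm
  have hpos := hG.pos_dist_of_ne hxz
  apply le_antisymm
  · have htri : G.dist x y ≤ G.dist x (par x) + G.dist (par x) y := hG.dist_triangle
    rwa [SimpleGraph.dist_eq_one_iff_adj.2 (h.adj_par x hxz), add_comm] at htri
  · obtain ⟨p, hp⟩ := hG.exists_walk_length_eq_dist x y
    refine dist_lt_of_mem_support hp (h.par_mem_support (fun v hv => ?_) fun i hi => ?_)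
      (h.adj_par x hxz).ne'
    · have hxy_tri : G.dist x y ≤ G.dist x z + G.dist z y := hG.dist_triangle
      have hvz_tri : G.dist v z ≤ G.dist v x + G.dist x z := hG.dist_triangle
      have hxv := (SimpleGraph.dist_le (p.takeUntil v hv)).trans (p.length_takeUntil_le_length hv)
      rw [G.dist_comm (u := z)] at hxy_tri
      rw [G.dist_comm (u := v) (v := x)] at hvz_tri
      lia
    · have hdist := h.dist_iterate i y
      rw [hi] at hdist
      obtain rfl : i = 0 := by lia
      exact hxy hi.symm

end IsTreeLike

section TreeVector

variable [DecidableEq W] {par : W → W} {t : ℝ}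

/-- The vectors `ξ_x = t ξ_{par x} + √(1 - t²) δ_x` attached to the vertices of a rooted tree, by
recursion on the distance of `x` to the root (the natural number argument). Their Gram matrix is
`t ^ d(x, y)`. -/
noncomputable def treeVector (par : W → W) (t : ℝ) : ℕ → W → W → ℝ
  | 0, x => Pi.single x 1
  | n + 1, x => t • treeVector par t n (par x) + Pi.single x √(1 - t ^ 2)

theorem treeVector_apply_eq_zero (h : IsTreeLike G z r par) {n : ℕ} {x u : W}
    (hx : G.dist x z = n) (hux : u ≠ x) (hu : G.dist x z ≤ G.dist u z) :
    treeVector par t n x u = 0 := by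
  induction n generalizing x with
  | zero => simp [treeVector, hux]
  | succ n ih =>
    have hdist := h.dist_par x
    have hne : u ≠ par x := by
      rintro rfl
      lia
    simp [treeVector, hux, ih (x := par x) (by lia) hne (by lia)]

variable [Fintype W]

theorem treeVector_dotProduct_self (h : IsTreeLike G z r par) (ht : t ^ 2 ≤ 1) {n : ℕ} {x : W}
    (hx : G.dist x z = n) : treeVector par t n x ⬝ᵥ treeVector par t n x = 1 := by
  induction n generalizing x with
  | zero => simp [treeVector]
  | succ n ih =>
    have hdist := h.dist_par x
    have hpar : G.dist (par x) z = n := by lia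
    have hzero : treeVector par t n (par x) x = 0 := by
      refine treeVector_apply_eq_zero h hpar (fun heq => ?_) (by lia)
      rw [← heq] at hpar
      lia
    simp only [treeVector, add_dotProduct, dotProduct_add, smul_dotProduct, dotProduct_smul,
      ih hpar, single_dotProduct, dotProduct_single, hzero, Pi.add_apply, Pi.smul_apply,
      Pi.single_eq_same, smul_eq_mul, mul_zero, zero_add, Real.mul_self_sqrt (sub_nonneg.2 ht)]
    ring

theorem treeVector_dotProduct_treeVector {s : ℕ} (hs : 3 * s ≤ r) (hG : G.Connected)
    (h : IsTreeLike G z r par) (ht : t ^ 2 ≤ 1) {x y : W} (hx : G.dist x z ≤ s)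
    (hy : G.dist y z ≤ s) :
    treeVector par t (G.dist x z) x ⬝ᵥ treeVector par t (G.dist y z) y = t ^ G.dist x y := by
  obtain ⟨N, hN⟩ : ∃ N, G.dist x z + G.dist y z = N := ⟨_, rfl⟩
  induction N generalizing x y with
  | zero =>
    obtain rfl : x = z := hG.dist_eq_zero_iff.1 (by lia)
    obtain rfl : y = x := hG.dist_eq_zero_iff.1 (by lia)
    simp [treeVector]
  | succ N ih =>
    wlog hle : G.dist y z ≤ G.dist x z generalizing x y with H
    · rw [dotProduct_comm, G.dist_comm (u := x) (v := y), H hy hx (by lia) (by lia)]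
    rcases eq_or_ne x y with rfl | hxy
    · rw [treeVector_dotProduct_self h ht rfl, SimpleGraph.dist_self, pow_zero]
    obtain ⟨n, hn⟩ : ∃ n, G.dist x z = n + 1 := ⟨G.dist x z - 1, by lia⟩
    have hpar : G.dist (par x) z = n := by
      rw [h.dist_par, hn, Nat.add_sub_cancel]
    have hprod := ih (x := par x) (y := y) (by lia) hy (by lia)
    rw [hpar] at hprod
    rw [hn, treeVector, add_dotProduct, smul_dotProduct, hprod, single_dotProduct,
      treeVector_apply_eq_zero h rfl hxy hle, mul_zero, add_zero, smul_eq_mul,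
      h.dist_eq_dist_par_add_one hs hG hxy hle hx, pow_succ']

end TreeVector

theorem re_sum_mul_dotProduct_nonneg {ι : Type*} [Fintype W] [Fintype ι] (a : W → ℂ)
    (ξ : W → ι → ℝ) : 0 ≤ (∑ x, ∑ y, star (a x) * a y * ((ξ x ⬝ᵥ ξ y : ℝ) : ℂ)).re := by
  have hsum : ∑ x, ∑ y, star (a x) * a y * ((ξ x ⬝ᵥ ξ y : ℝ) : ℂ) =
      ∑ i, ((‖∑ x, a x * (ξ x i : ℂ)‖ ^ 2 : ℝ) : ℂ) := calc
    _ = ∑ x, ∑ y, ∑ i, star (a x * (ξ x i : ℂ)) * (a y * (ξ y i : ℂ)) := by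
      simp only [dotProduct, Complex.ofReal_sum, Finset.mul_sum]
      refine Finset.sum_congr rfl fun x _ => Finset.sum_congr rfl fun y _ =>
        Finset.sum_congr rfl fun i _ => ?_
      rw [star_mul', Complex.star_def, Complex.conj_ofReal, Complex.ofReal_mul]
      ring
    _ = ∑ x, ∑ i, ∑ y, star (a x * (ξ x i : ℂ)) * (a y * (ξ y i : ℂ)) :=
      Finset.sum_congr rfl fun x _ => Finset.sum_comm
    _ = ∑ i, ∑ x, ∑ y, star (a x * (ξ x i : ℂ)) * (a y * (ξ y i : ℂ)) := Finset.sum_comm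
    _ = _ := Finset.sum_congr rfl fun i _ => by
      rw [← Finset.sum_mul_sum, ← star_sum, Complex.star_def, Complex.conj_mul',
        Complex.ofReal_pow]
  rw [hsum, ← Complex.ofReal_sum, Complex.ofReal_re]
  exact Finset.sum_nonneg fun i _ => sq_nonneg _

theorem re_sum_pow_dist_nonneg [Fintype W] (hG : G.Connected) {s : ℕ}
    (h : ∀ x y, G.dist x z ≤ 3 * s → s(x, y) ∉ detourEdges G (2 * (3 * s))) {t : ℝ}
    (ht : t ^ 2 ≤ 1) (a : W → ℂ) (ha : ∀ x, a x ≠ 0 → G.dist x z ≤ s) :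
    0 ≤ (∑ x, ∑ y, star (a x) * a y * ((t ^ G.dist x y : ℝ) : ℂ)).re := by
  classical
  obtain ⟨par, hpar⟩ := exists_isTreeLike hG h
  have hgram : ∀ x y, star (a x) * a y * ((t ^ G.dist x y : ℝ) : ℂ) = star (a x) * a y *
      ((treeVector par t (G.dist x z) x ⬝ᵥ treeVector par t (G.dist y z) y : ℝ) : ℂ) := by
    intro x y
    by_cases hx : a x = 0
    · simp [hx]
    by_cases hy : a y = 0
    · simp [hy]
    rw [treeVector_dotProduct_treeVector le_rfl hG hpar ht (ha x hx) (ha y hy)]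
  simp only [hgram]
  exact re_sum_mul_dotProduct_nonneg a fun x => treeVector par t (G.dist x z) x

end TreeLike

/-! ### Elements of the algebraic uniform Roe algebra -/

open Matrix in
theorem sum_adj_star_sub_mul_sub {W : Type*} [Fintype W] [DecidableEq W] (G : SimpleGraph W)
    [DecidableRel G.Adj] (f g : W → ℂ) :
    ∑ x, ∑ y, (if G.Adj x y then star (f x - f y) * (g x - g y) else 0) =
      2 * (star f ⬝ᵥ G.lapMatrix ℂ *ᵥ g) := by
  have hlap : star f ⬝ᵥ G.lapMatrix ℂ *ᵥ g =
      ∑ x, ∑ y, if G.Adj x y then star (f x) * (g x - g y) else 0 := by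
    refine Finset.sum_congr rfl fun x _ => ?_
    rw [SimpleGraph.lapMatrix_mulVec_apply, ← Finset.sum_filter, ← Finset.mul_sum,
      Finset.sum_sub_distrib, Finset.sum_const, nsmul_eq_mul,
      ← SimpleGraph.neighborFinset_eq_filter, SimpleGraph.card_neighborFinset_eq_degree,
      Pi.star_apply]
  have hswap : ∑ x, ∑ y, (if G.Adj x y then star (f y) * (g x - g y) else 0) =
      -∑ x, ∑ y, if G.Adj x y then star (f x) * (g x - g y) else 0 := by
    rw [Finset.sum_comm]
    simp only [← Finset.sum_neg_distrib]
    refine Finset.sum_congr rfl fun x _ => Finset.sum_congr rfl fun y _ => ?_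
    simp only [G.adj_comm y x, ← neg_sub (g x) (g y), mul_neg]
    split_ifs <;> simp
  calc _ = ∑ x, ∑ y, (if G.Adj x y then star (f x) * (g x - g y) else 0) -
        ∑ x, ∑ y, (if G.Adj x y then star (f y) * (g x - g y) else 0) := by
        simp only [← Finset.sum_sub_distrib, star_sub, sub_mul, ite_sub_ite, sub_zero]
    _ = 2 * (star f ⬝ᵥ G.lapMatrix ℂ *ᵥ g) := by rw [hswap, hlap]; ring

section RoeElements

variable {V : ℕ → Type u} [∀ n, Fintype (V n)]

/-- The maps `e k` enumerate the points `≠ x` of every ball of radius `R` without repetition;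
superfluous values are `x` itself, so that they do not contribute to a sum over functions vanishing
at `x`. -/
structure IsBallEnumeration (X : ∀ n, SimpleGraph (V n)) (R : ℕ) {N : ℕ}
    (e : Fin N → ∀ n, V n → V n) : Prop where
  edist_le : ∀ k n x, (X n).edist x (e k n x) ≤ R
  sum_eq : ∀ n x (f : V n → ℂ), f x = 0 → (∀ y, f y ≠ 0 → (X n).edist x y ≤ R) →
    ∑ k, f (e k n x) = ∑ y, f y

/-- The displacement of a self-map of the vertex sets is bounded. -/
abbrev BoundedDisplacement (X : ∀ n, SimpleGraph (V n)) (b : ∀ n, V n → V n) : Prop :=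
  ∃ R : ℕ, ∀ n x, (X n).edist x (b n x) ≤ R

theorem IsBallEnumeration.boundedDisplacement {X : ∀ n, SimpleGraph (V n)} {N R : ℕ}
    {e : Fin N → ∀ n, V n → V n} (he : IsBallEnumeration X R e) (k : Fin N) :
    BoundedDisplacement X (e k) := ⟨R, he.edist_le k⟩

theorem exists_isBallEnumeration (X : ∀ n, SimpleGraph (V n)) [UniformlyBoundedDegree X] (R : ℕ) :
    ∃ (N : ℕ) (e : Fin N → ∀ n, V n → V n), IsBallEnumeration X R e := by
  classical
  obtain ⟨N, hN⟩ := exists_ball_bound X R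
  have hemb : ∀ n (x : V n), Nonempty ({y | (X n).edist x y ≤ R} ↪ Fin N) := fun n x => by
    rw [Function.Embedding.nonempty_iff_card_le, Fintype.card_fin, ← Nat.card_eq_fintype_card]
    exact hN n x
  let ι := fun n x => (hemb n x).some
  refine ⟨N, fun k n x => Function.extend (ι n x) (↑) (fun _ => x) k, fun k n x => ?_,
    fun n x f hfx hf => ?_⟩
  · by_cases hk : ∃ y, ι n x y = k
    · obtain ⟨y, rfl⟩ := hk
      rw [(ι n x).injective.extend_apply]
      exact y.2
    · rw [Function.extend_apply' _ _ _ hk, SimpleGraph.edist_self]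
      exact zero_le
  · calc ∑ k, f (Function.extend (ι n x) (↑) (fun _ => x) k)
        = ∑ y : {y | (X n).edist x y ≤ R}, f y := by
          symm
          refine Fintype.sum_of_injective _ (ι n x).injective _ _ (fun k hk => ?_) fun y => ?_
          · rw [Function.extend_apply' _ _ _ hk, hfx]
          · rw [(ι n x).injective.extend_apply]
      _ = ∑ y, f y := by
          refine Fintype.sum_of_injective _ Subtype.val_injective _ _ (fun y hy => ?_) fun _ => rfl
          by_contra hfy
          exact hy ⟨⟨y, hf y hfy⟩, rfl⟩

variable [∀ n, DecidableEq (V n)] {X : ∀ n, SimpleGraph (V n)}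

instance : StarModule ℂ (AlgebraicRoe X) := inferInstanceAs (StarModule ℂ (roeSubalgebra X))

namespace AlgebraicRoe

/-- The sequence of matrices underlying an element of `ℂ_cs[X]`. -/
def entries : AlgebraicRoe X →⋆ₐ[ℂ] (∀ n, Matrix (V n) (V n) ℂ) := (roeSubalgebra X).subtype

theorem ext {S T : AlgebraicRoe X} (h : ∀ n x y, S.entries n x y = T.entries n x y) : S = T :=
  Subtype.ext (funext fun n => Matrix.ext fun x y => h n x y)

theorem entries_mul (S T : AlgebraicRoe X) (n : ℕ) (x y : V n) :
    (S * T).entries n x y = ∑ z, S.entries n x z * T.entries n z y := by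
  rw [map_mul, Pi.mul_apply, Matrix.mul_apply]

theorem entries_star (S : AlgebraicRoe X) (n : ℕ) (x y : V n) :
    (star S).entries n x y = star (S.entries n y x) := by
  rw [map_star, Pi.star_apply, Matrix.star_apply]

theorem entries_sum {ι : Type*} (s : Finset ι) (S : ι → AlgebraicRoe X) (n : ℕ) (x y : V n) :
    (∑ i ∈ s, S i).entries n x y = ∑ i ∈ s, (S i).entries n x y := by
  rw [map_sum, Finset.sum_apply, Matrix.sum_apply]

theorem entries_one (n : ℕ) (x y : V n) :
    (1 : AlgebraicRoe X).entries n x y = if x = y then 1 else 0 := by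
  rw [map_one, Pi.one_apply, Matrix.one_apply]

theorem entries_sub (S T : AlgebraicRoe X) (n : ℕ) (x y : V n) :
    (S - T).entries n x y = S.entries n x y - T.entries n x y := by
  rw [map_sub, Pi.sub_apply, Matrix.sub_apply]

theorem entries_smul (c : ℂ) (T : AlgebraicRoe X) (n : ℕ) (x y : V n) :
    (c • T).entries n x y = c * T.entries n x y := by
  rw [map_smul, Pi.smul_apply, Matrix.smul_apply, smul_eq_mul]

theorem norm_entries_le (T : AlgebraicRoe X) : ∃ M : ℝ, ∀ n x y, ‖T.entries n x y‖ ≤ M := by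
  obtain ⟨T, ⟨C, hC⟩, hT⟩ := T
  refine ⟨C, fun n x y => ?_⟩
  set A := Matrix.toEuclideanCLM (𝕜 := ℂ) (T n) with hA
  calc ‖T n x y‖ = ‖A (EuclideanSpace.single y 1) x‖ := by
        rw [hA, Matrix.ofLp_toEuclideanCLM]
        simp
    _ ≤ ‖A (EuclideanSpace.single y 1)‖ := PiLp.norm_apply_le _ x
    _ ≤ ‖A‖ * ‖EuclideanSpace.single y (1 : ℂ)‖ := A.le_opNorm _
    _ = ‖A‖ := by rw [PiLp.norm_single, norm_one, mul_one]
    _ ≤ C := hC n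

theorem finitePropagation_entries (T : AlgebraicRoe X) : FinitePropagation X T.entries := T.2.2

end AlgebraicRoe

open AlgebraicRoe

variable (X) [UniformlyBoundedDegree X]

/-- Composition with a self-map of bounded displacement. -/
noncomputable def roeMap (b : ∀ n, V n → V n) (hb : BoundedDisplacement X b) : AlgebraicRoe X :=
  ⟨fun n => Matrix.of fun x y => if y = b n x then 1 else 0, by
    obtain ⟨R, hR⟩ := hb
    refine mem_roeSubalgebra_of_entries X _ ⟨R, fun n x y hxy => ?_⟩ 1 fun n x y => ?_
    · obtain rfl : y = b n x := of_not_not fun hy => hxy (if_neg hy)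
      exact hR n x
    · rw [Matrix.of_apply]
      split_ifs <;> simp⟩

/-- Multiplication by a bounded function. -/
noncomputable def roeDiag (w : ∀ n, V n → ℂ) (hw : ∃ M : ℝ, ∀ n x, ‖w n x‖ ≤ M) :
    AlgebraicRoe X :=
  ⟨fun n => Matrix.diagonal (w n), by
    obtain ⟨M, hM⟩ := hw
    refine mem_roeSubalgebra_of_entries X _ ⟨0, fun n x y hxy => ?_⟩ M fun n x y => ?_
    · obtain rfl : x = y := of_not_not fun hne => hxy (Matrix.diagonal_apply_ne _ hne)
      simp
    · rcases eq_or_ne x y with rfl | hxy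
      · simpa using hM n x
      · rw [Matrix.diagonal_apply_ne _ hxy, norm_zero]
        exact (norm_nonneg _).trans (hM n x)⟩

variable {X}

theorem roeMap_entries (b : ∀ n, V n → V n) (hb : BoundedDisplacement X b) (n : ℕ) (x y : V n) :
    (roeMap X b hb).entries n x y = if y = b n x then 1 else 0 := rfl

theorem roeDiag_mul_entries (w : ∀ n, V n → ℂ) (hw : ∃ M : ℝ, ∀ n x, ‖w n x‖ ≤ M)
    (T : AlgebraicRoe X) (n : ℕ) (x y : V n) :
    (roeDiag X w hw * T).entries n x y = w n x * T.entries n x y := by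
  rw [map_mul, Pi.mul_apply]
  exact Matrix.diagonal_mul _ _ _ _

theorem roeMap_mul_entries (b : ∀ n, V n → V n) (hb : BoundedDisplacement X b)
    (T : AlgebraicRoe X) (n : ℕ) (x y : V n) :
    (roeMap X b hb * T).entries n x y = T.entries n (b n x) y := by
  simp [entries_mul, roeMap_entries]

theorem roeMap_sub_one_entries (b : ∀ n, V n → V n) (hb : BoundedDisplacement X b) (n : ℕ)
    (x y : V n) : (roeMap X b hb - 1).entries n x y =
      (Pi.single y 1 : V n → ℂ) (b n x) - (Pi.single y 1 : V n → ℂ) x := by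
  simp only [entries_sub, roeMap_entries, entries_one, Pi.single_apply, eq_comm (a := y)]

theorem roeMap_eq_one {b : ∀ n, V n → V n} (h : ∀ n x, b n x = x) :
    roeMap X b ⟨0, fun n x => by simp [h]⟩ = 1 :=
  AlgebraicRoe.ext fun n x y => by
    simp only [roeMap_entries, entries_one, h, eq_comm (a := y)]

theorem star_roeLaplacian : star (roeLaplacian X) = roeLaplacian X := by
  classical
  refine AlgebraicRoe.ext fun n x y => ?_
  rw [entries_star]
  change star ((X n).lapMatrix ℂ y x) = (X n).lapMatrix ℂ x y
  simp only [SimpleGraph.lapMatrix, SimpleGraph.degMatrix, Matrix.sub_apply,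
    SimpleGraph.adjMatrix_apply, (X n).adj_comm y x, Matrix.diagonal_apply]
  rcases eq_or_ne x y with rfl | hxy
  · simp
  · simp [hxy, hxy.symm, apply_ite star]

namespace IsBallEnumeration

variable {N R : ℕ} {e : Fin N → ∀ n, V n → V n}

open Matrix in
theorem sum_star_mul_eq_roeLaplacian (he : IsBallEnumeration X 1 e) :
    ∑ k, star (roeMap X (e k) (he.boundedDisplacement k) - 1) *
      (roeMap X (e k) (he.boundedDisplacement k) - 1) = (2 : ℂ) • roeLaplacian X := by
  classical
  refine AlgebraicRoe.ext fun n u w => ?_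
  let f : V n → ℂ := Pi.single u 1
  let g : V n → ℂ := Pi.single w 1
  have hadj : ∀ x, ∑ k, star (f (e k n x) - f x) * (g (e k n x) - g x) =
      ∑ y, if (X n).Adj x y then star (f x - f y) * (g x - g y) else 0 := by
    intro x
    rw [← he.sum_eq n x _ (by simp)]
    · refine Finset.sum_congr rfl fun k _ => ?_
      rcases SimpleGraph.edist_le_one_iff_adj_or_eq.1 (he.edist_le k n x) with hk | hk
      · rw [if_pos hk, ← neg_sub (f x), ← neg_sub (g x), star_neg, neg_mul_neg]
      · rw [← hk, sub_self (g x), mul_zero, ite_self]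
    · intro y hy
      exact SimpleGraph.edist_le_one_iff_adj_or_eq.2 (.inl (of_not_not fun h => hy (if_neg h)))
  calc _ = ∑ x, ∑ k, star (f (e k n x) - f x) * (g (e k n x) - g x) := by
        simp only [entries_sum, entries_mul, entries_star, roeMap_sub_one_entries]
        exact Finset.sum_comm
    _ = 2 * (star f ⬝ᵥ (X n).lapMatrix ℂ *ᵥ g) := by
        simp only [hadj, sum_adj_star_sub_mul_sub]
    _ = _ := by
        rw [entries_smul, Matrix.mulVec_single_one, ← Pi.single_star, star_one,
          single_one_dotProduct]
        rfl

theorem sum_roeDiag_mul_eq_sub_one (he : IsBallEnumeration X R e) (T : AlgebraicRoe X)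
    (hbound : ∃ M : ℝ, ∀ n x y, ‖T.entries n x y‖ ≤ M)
    (hprop : ∀ n x y, T.entries n x y ≠ 0 → (X n).edist x y ≤ R)
    (hT : ∀ n x, ∑ y, T.entries n x y = 1) :
    ∑ k, roeDiag X (fun n x => T.entries n x (e k n x)) (hbound.imp fun _ hM n x => hM n x _) *
      (roeMap X (e k) (he.boundedDisplacement k) - 1) = T - 1 := by
  refine AlgebraicRoe.ext fun n x y => ?_
  simp only [entries_sum, roeDiag_mul_entries, roeMap_sub_one_entries]
  rw [he.sum_eq n x (fun z => T.entries n x z *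
    ((Pi.single y 1 : V n → ℂ) z - (Pi.single y 1 : V n → ℂ) x)) (by simp)
    fun z hz => hprop n x z (left_ne_zero_of_mul hz)]
  simp only [mul_sub, Finset.sum_sub_distrib, ← Finset.sum_mul, hT, entries_sub, entries_one]
  simp [Pi.single_apply]

theorem sum_roeDiag_mul_eq_roeMap_sub (he : IsBallEnumeration X R e) {b c : ∀ n, V n → V n}
    (hb : BoundedDisplacement X b) (hc : BoundedDisplacement X c)
    (hbc : ∀ n x, (X n).edist (c n x) (b n x) ≤ R) :
    ∑ k, roeDiag X (fun n x => if e k n (c n x) = b n x then 1 else 0)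
        ⟨1, fun n x => by split_ifs <;> simp⟩ *
      (roeMap X c hc * (roeMap X (e k) (he.boundedDisplacement k) - 1)) =
      roeMap X b hb - roeMap X c hc := by
  refine AlgebraicRoe.ext fun n x y => ?_
  simp only [entries_sum, roeDiag_mul_entries, roeMap_mul_entries, roeMap_sub_one_entries]
  rw [he.sum_eq n (c n x) (fun z => (if z = b n x then 1 else 0) *
    ((Pi.single y 1 : V n → ℂ) z - (Pi.single y 1 : V n → ℂ) (c n x))) (by simp) fun z hz => ?_]
  · simp [roeMap_entries, Pi.single_apply, entries_sub, eq_comm (a := y)]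
  · obtain rfl : z = b n x := of_not_not fun h => hz (by rw [if_neg h, zero_mul])
    exact hbc n x

end IsBallEnumeration

/-! ### Invariant vectors -/

section Invariant

variable {H : Type*} [NormedAddCommGroup H] [InnerProductSpace ℂ H] [CompleteSpace H]

theorem norm_map_apply_sq {A : Type*} [Ring A] [StarRing A] [Algebra ℂ A]
    (π : A →⋆ₐ[ℂ] (H →L[ℂ] H)) (a : A) (w : H) :
    ‖π a w‖ ^ 2 = (inner ℂ w (π (star a * a) w)).re := by
  rw [map_mul, map_star]
  exact (π a).apply_norm_sq_eq_inner_adjoint_right w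

variable (π : AlgebraicRoe X →⋆ₐ[ℂ] (H →L[ℂ] H)) {w : H}

theorem map_sub_one_eq_zero_of_map_roeLaplacian (hw : π (roeLaplacian X) w = 0) {N : ℕ}
    {e : Fin N → ∀ n, V n → V n} (he : IsBallEnumeration X 1 e) (k : Fin N) :
    π (roeMap X (e k) (he.boundedDisplacement k) - 1) w = 0 := by
  have hsum : ∑ k, ‖π (roeMap X (e k) (he.boundedDisplacement k) - 1) w‖ ^ 2 = 0 := by
    simp only [norm_map_apply_sq]
    rw [← Complex.re_sum, ← inner_sum, ← sum_apply, ← map_sum, he.sum_star_mul_eq_roeLaplacian,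
      map_smul, smul_apply, hw, smul_zero, inner_zero_right, Complex.zero_re]
  have hzero := (Finset.sum_eq_zero_iff_of_nonneg fun k _ => sq_nonneg _).1 hsum k
    (Finset.mem_univ k)
  exact norm_eq_zero.1 (sq_eq_zero_iff.1 hzero)

theorem exists_edist_le_of_edist_le_add_one {W : Type*} {G : SimpleGraph W} {x y : W} {R : ℕ}
    (h : G.edist x y ≤ (R + 1 : ℕ)) : ∃ z, G.edist x z ≤ R ∧ G.edist z y ≤ (1 : ℕ) := by
  obtain ⟨p, hp⟩ :=
    SimpleGraph.exists_walk_of_edist_ne_top (ne_top_of_le_ne_top (ENat.natCast_ne_top _) h)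
  have hlen : p.reverse.length ≤ R + 1 := by
    rw [← hp] at h
    rw [SimpleGraph.Walk.length_reverse]
    exact_mod_cast h
  cases hq : p.reverse with
  | nil => exact ⟨x, by simp, by simp⟩
  | @cons _ z _ hadj q =>
    rw [hq, SimpleGraph.Walk.length_cons] at hlen
    refine ⟨z, ?_, SimpleGraph.edist_le_one_iff_adj_or_eq.2 (.inl hadj.symm)⟩
    rw [SimpleGraph.edist_comm]
    exact (SimpleGraph.edist_le q).trans (by exact_mod_cast Nat.le_of_succ_le_succ hlen)

theorem map_roeMap_of_map_roeLaplacian (hw : π (roeLaplacian X) w = 0) (b : ∀ n, V n → V n)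
    (hb : BoundedDisplacement X b) : π (roeMap X b hb) w = w := by
  obtain ⟨N, e, he⟩ := exists_isBallEnumeration X 1
  obtain ⟨R, hR⟩ := hb
  induction R generalizing b with
  | zero =>
    have hid : ∀ n x, b n x = x := fun n x =>
      (SimpleGraph.edist_eq_zero_iff.1 (nonpos_iff_eq_zero.1 (by exact_mod_cast hR n x))).symm
    rw [roeMap_eq_one hid, map_one, one_apply_eq_self]
  | succ R ih =>
    choose c hxc hcb using fun n x => exists_edist_le_of_edist_le_add_one (hR n x)
    have hzero : π (roeMap X b ⟨R + 1, hR⟩ - roeMap X c ⟨R, hxc⟩) w = 0 := by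
      rw [← he.sum_roeDiag_mul_eq_roeMap_sub ⟨R + 1, hR⟩ ⟨R, hxc⟩ hcb, map_sum, sum_apply]
      refine Finset.sum_eq_zero fun k _ => ?_
      rw [map_mul, map_mul, mul_apply_eq_comp, mul_apply_eq_comp,
        map_sub_one_eq_zero_of_map_roeLaplacian π hw he k, map_zero, map_zero]
    rwa [map_sub, sub_apply, ih c hxc, sub_eq_zero] at hzero

theorem map_eq_self_of_map_roeLaplacian (hw : π (roeLaplacian X) w = 0) (T : AlgebraicRoe X)
    (hT : ∀ n x, ∑ y, T.entries n x y = 1) : π T w = w := by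
  obtain ⟨R, hR⟩ := finitePropagation_entries T
  obtain ⟨N, e, he⟩ := exists_isBallEnumeration X R
  have hzero : π (T - 1) w = 0 := by
    rw [← he.sum_roeDiag_mul_eq_sub_one T (norm_entries_le T) hR hT, map_sum, sum_apply]
    refine Finset.sum_eq_zero fun k _ => ?_
    rw [map_mul, mul_apply_eq_comp, map_sub, map_one, sub_apply, one_apply_eq_self,
      map_roeMap_of_map_roeLaplacian π hw, sub_self, map_zero]
  rwa [map_sub, map_one, sub_apply, one_apply_eq_self, sub_eq_zero] at hzero

end Invariant

end RoeElements

/-! ### Averaging over cells -/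

section Cells

variable {W : Type*} {G : SimpleGraph W}

theorem min_le_ncard_ball [Finite W] (hG : G.Connected) (c : W) (ρ : ℕ) :
    min (ρ + 1) (Nat.card W) ≤ {y | G.dist c y ≤ ρ}.ncard := by
  by_cases h : ∀ y, G.dist c y ≤ ρ
  · rw [show {y | G.dist c y ≤ ρ} = Set.univ from Set.eq_univ_of_forall h, Set.ncard_univ]
    exact min_le_right _ _
  · push Not at h
    obtain ⟨y, hy⟩ := h
    obtain ⟨p, hp, hlen⟩ := hG.exists_path_of_dist c y
    have hdist : ∀ i ∈ Set.Iic ρ, p.getVert i ∈ {y | G.dist c y ≤ ρ} := fun i hi =>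
      (SimpleGraph.dist_le (p.take i)).trans ((p.take_length i).trans_le
        ((min_le_left _ _).trans hi))
    have hinj : Set.InjOn p.getVert (Set.Iic ρ) := hp.getVert_injOn.mono fun i hi =>
      le_trans hi (hy.le.trans_eq hlen.symm)
    calc min (ρ + 1) (Nat.card W) ≤ ρ + 1 := min_le_left _ _
      _ = (Set.Iic ρ).ncard := by rw [Set.ncard_eq_toFinset_card', Set.toFinset_Iic, Nat.card_Iic]
      _ ≤ _ := Set.ncard_le_ncard_of_injOn _ hdist hinj

theorem exists_separated_dominating [Finite W] (G : SimpleGraph W) (r : ℕ) :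
    ∃ S : Set W, (S.Pairwise fun c c' => r < G.dist c c') ∧ ∀ x, ∃ c ∈ S, G.dist x c ≤ r := by
  obtain ⟨S, hS⟩ := (Set.toFinite {S : Set W | S.Pairwise fun c c' => r < G.dist c c'})
    |>.exists_maximal ⟨∅, Set.pairwise_empty _⟩
  refine ⟨S, hS.prop, fun x => ?_⟩
  by_contra! hx
  have hins : (insert x S).Pairwise fun c c' => r < G.dist c c' :=
    Set.pairwise_insert.2 ⟨hS.prop, fun c hc _ => ⟨hx c hc, G.dist_comm ▸ hx c hc⟩⟩
  have hxS : x ∈ S := hS.le_of_ge hins (Set.subset_insert x S) (Set.mem_insert x S)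
  exact (hx x hxS).not_ge (by simp)

theorem exists_cells [Finite W] (hG : G.Connected) (ρ : ℕ) :
    ∃ cell : W → W, (∀ x, G.dist x (cell x) ≤ 2 * ρ) ∧
      ∀ x, min (ρ + 1) (Nat.card W) ≤ {y | cell y = cell x}.ncard := by
  obtain ⟨S, hsep, hdom⟩ := exists_separated_dominating G (2 * ρ)
  have hnearest : ∀ x, ∃ c ∈ S, ∀ c' ∈ S, G.dist x c ≤ G.dist x c' := fun x =>
    S.exists_min_image (G.dist x) S.toFinite ((hdom x).imp fun _ h => h.1)
  choose cell hmem hle using hnearest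
  refine ⟨cell, fun x => ?_, fun x => (min_le_ncard_ball hG (cell x) ρ).trans
    (Set.ncard_le_ncard (fun y hy => ?_) (Set.toFinite _))⟩
  · obtain ⟨c, hc, hxc⟩ := hdom x
    exact (hle x c hc).trans hxc
  · by_contra hne
    have hy' : G.dist y (cell x) ≤ ρ := G.dist_comm.trans_le hy
    have hfar := hsep (hmem y) (hmem x) hne
    have htri : G.dist (cell y) (cell x) ≤ G.dist y (cell y) + G.dist y (cell x) :=
      hG.dist_triangle.trans_eq (by rw [G.dist_comm (u := cell y)])
    have hnear := hle y _ (hmem x)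
    lia

end Cells

section CellAverage

open Classical in
/-- The matrix of the conditional expectation onto the functions that are constant on the fibres of
`cell`. -/
noncomputable def cellAverage {W ι : Type*} (cell : W → ι) : Matrix W W ℝ :=
  Matrix.of fun x y => if cell y = cell x then ({z | cell z = cell x}.ncard : ℝ)⁻¹ else 0

variable {W ι : Type*} (cell : W → ι)

theorem cellAverage_apply_of_ne {x y : W} (h : cell y ≠ cell x) : cellAverage cell x y = 0 :=
  if_neg h

theorem cellAverage_nonneg (x y : W) : 0 ≤ cellAverage cell x y := by
  unfold cellAverage
  rw [Matrix.of_apply]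
  split_ifs <;> positivity

theorem cellAverage_comm (x y : W) : cellAverage cell x y = cellAverage cell y x := by
  by_cases h : cell y = cell x
  · simp only [cellAverage, Matrix.of_apply, h]
  · rw [cellAverage_apply_of_ne cell h, cellAverage_apply_of_ne cell (Ne.symm h)]

theorem cellAverage_le {m : ℕ} {x : W} (hm : m ≤ {z | cell z = cell x}.ncard) (hm0 : 0 < m)
    (y : W) : cellAverage cell x y ≤ (m : ℝ)⁻¹ := by
  unfold cellAverage
  rw [Matrix.of_apply]
  split_ifs
  · exact inv_anti₀ (by exact_mod_cast hm0) (by exact_mod_cast hm)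
  · positivity

variable [Fintype W]

theorem sum_cellAverage (x : W) : ∑ y, cellAverage cell x y = 1 := by
  classical
  have hpos : 0 < {z | cell z = cell x}.ncard := (Set.ncard_pos (Set.toFinite _)).2 ⟨x, rfl⟩
  simp only [cellAverage, Matrix.of_apply]
  rw [← Finset.sum_filter, Finset.sum_const, nsmul_eq_mul, ← Set.ncard_coe_finset,
    Finset.coe_filter_univ]
  exact mul_inv_cancel₀ (by exact_mod_cast hpos.ne')

theorem cellAverage_mul_self : cellAverage cell * cellAverage cell = cellAverage cell := by
  ext x y
  have hterm : ∀ z, cellAverage cell x z * cellAverage cell z y =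
      cellAverage cell x z * cellAverage cell x y := fun z => by
    by_cases h : cell z = cell x
    · unfold cellAverage
      simp only [Matrix.of_apply]
      rw [h]
    · simp only [cellAverage_apply_of_ne cell h, zero_mul]
  rw [Matrix.mul_apply, Finset.sum_congr rfl fun z _ => hterm z, ← Finset.sum_mul,
    sum_cellAverage, one_mul]

end CellAverage

section AveragingProjection

variable {V : ℕ → Type u} [∀ n, Fintype (V n)] [∀ n, DecidableEq (V n)]
  (X : ∀ n, SimpleGraph (V n)) [UniformlyBoundedDegree X]

theorem cellAverage_mem_roeSubalgebra {cell : ∀ n, V n → V n} {r : ℕ}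
    (hcell : ∀ n x, (X n).edist x (cell n x) ≤ r) :
    (fun n => (cellAverage (cell n)).map Complex.ofRealHom) ∈ roeSubalgebra X := by
  refine mem_roeSubalgebra_of_entries X _ ⟨r + r, fun n x y hxy => ?_⟩ 1 fun n x y => ?_
  · have hcxy : cell n y = cell n x := of_not_not fun hne =>
      hxy (by simp [cellAverage_apply_of_ne _ hne])
    calc (X n).edist x y ≤ (X n).edist x (cell n x) + (X n).edist (cell n x) y :=
          SimpleGraph.edist_triangle
      _ = (X n).edist x (cell n x) + (X n).edist y (cell n y) := by
          rw [hcxy, (X n).edist_comm (u := y)]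
      _ ≤ r + r := add_le_add (hcell n x) (hcell n y)
      _ = (r + r : ℕ) := (Nat.cast_add r r).symm
  · rw [Matrix.map_apply, Complex.ofRealHom_eq_coe, Complex.norm_real,
      Real.norm_of_nonneg (cellAverage_nonneg _ x y), ← sum_cellAverage (cell n) x]
    exact Finset.single_le_sum (fun z _ => cellAverage_nonneg _ x z) (Finset.mem_univ y)

theorem exists_averaging_projection (hconn : ∀ n, (X n).Connected) (ρ : ℕ) :
    ∃ (A : AlgebraicRoe X) (a : ∀ n, Matrix (V n) (V n) ℝ), IsStarProjection A ∧
      (∀ n, A.entries n = (a n).map Complex.ofRealHom) ∧ (∀ n x y, 0 ≤ a n x y) ∧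
      (∀ n x, ∑ y, a n x y = 1) ∧
      ∀ n, ρ + 1 ≤ Fintype.card (V n) → ∀ x y, a n x y ≤ ((ρ + 1 : ℕ) : ℝ)⁻¹ := by
  choose cell hcell hcard using fun n => exists_cells (hconn n) ρ
  have hcell' : ∀ n x, (X n).edist x (cell n x) ≤ (2 * ρ : ℕ) := fun n x => by
    rw [← ((hconn n).preconnected x _).coe_dist_eq_edist]
    exact_mod_cast hcell n x
  let A : AlgebraicRoe X := ⟨_, cellAverage_mem_roeSubalgebra X hcell'⟩
  have hA : ∀ n, A.entries n = (cellAverage (cell n)).map Complex.ofRealHom := fun n => rfl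
  refine ⟨A, fun n => cellAverage (cell n), ⟨AlgebraicRoe.ext fun n x y => ?_,
    AlgebraicRoe.ext fun n x y => ?_⟩, hA, fun n => cellAverage_nonneg (cell n),
    fun n => sum_cellAverage (cell n), fun n hn x y => ?_⟩
  · rw [map_mul, Pi.mul_apply, hA, ← Matrix.map_mul, cellAverage_mul_self]
  · rw [AlgebraicRoe.entries_star, hA, Matrix.map_apply, Matrix.map_apply, cellAverage_comm]
    exact Complex.conj_ofReal _
  · refine cellAverage_le (cell n) ?_ ρ.succ_pos y
    rw [← Nat.card_eq_fintype_card] at hn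
    exact (min_eq_left hn).symm.trans_le (hcard n x)

end AveragingProjection

/-! ### Pairing a matrix with the kernel `t ^ d(x, y)` -/

section KernelMean

variable {W : Type*}

/-- The vertices within distance `r` of an edge with a detour of length at most `2 * r`. -/
def nearDetours (G : SimpleGraph W) (r : ℕ) : Set W :=
  {z | ∃ x y, G.dist x z ≤ r ∧ s(x, y) ∈ detourEdges G (2 * r)}

theorem ncard_nearDetours_le [Finite W] {G : SimpleGraph W} {r N : ℕ}
    (hN : ∀ x, {y | G.dist x y ≤ r}.ncard ≤ N) :
    (nearDetours G r).ncard ≤ (detourEdges G (2 * r)).ncard * (2 * N) := by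
  have hfin : (detourEdges G (2 * r)).Finite := Set.toFinite _
  have hcover : nearDetours G r ⊆ ⋃ e ∈ hfin.toFinset,
      ({z | G.dist e.out.1 z ≤ r} ∪ {z | G.dist e.out.2 z ≤ r}) := by
    rintro z ⟨x, y, hx, he⟩
    refine Set.mem_biUnion (x := s(x, y)) (hfin.mem_toFinset.2 he) ?_
    have hout : s((s(x, y) : Sym2 W).out.1, (s(x, y) : Sym2 W).out.2) = s(x, y) := Quot.out_eq _
    rcases Sym2.eq_iff.1 hout with ⟨hout₁, -⟩ | ⟨-, hout₂⟩
    · exact .inl (by rwa [Set.mem_ofPred_eq, hout₁])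
    · exact .inr (by rwa [Set.mem_ofPred_eq, hout₂])
  calc (nearDetours G r).ncard
      ≤ ∑ e ∈ hfin.toFinset, ({z | G.dist e.out.1 z ≤ r} ∪ {z | G.dist e.out.2 z ≤ r}).ncard :=
        (Set.ncard_le_ncard hcover (Set.toFinite _)).trans (Finset.set_ncard_biUnion_le _ _)
    _ ≤ hfin.toFinset.card • (2 * N) := Finset.sum_le_card_nsmul _ _ _ fun e _ =>
        (Set.ncard_union_le _ _).trans ((add_le_add (hN _) (hN _)).trans_eq (two_mul N).symm)
    _ = _ := by rw [smul_eq_mul, Set.ncard_eq_toFinset_card _ hfin]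

variable [Fintype W]

/-- The normalised pairing `|W|⁻¹ ∑ T x y * t ^ d(x, y)` of a matrix with the kernel `t ^ d` of a
graph. -/
noncomputable def kernelMean (G : SimpleGraph W) (t : ℝ) (T : Matrix W W ℂ) : ℂ :=
  (∑ x, ∑ y, T x y * ((t ^ G.dist x y : ℝ) : ℂ)) / (Fintype.card W : ℂ)

variable (G : SimpleGraph W) (t : ℝ)

theorem kernelMean_add (S T : Matrix W W ℂ) :
    kernelMean G t (S + T) = kernelMean G t S + kernelMean G t T := by
  simp only [kernelMean, Matrix.add_apply, add_mul, Finset.sum_add_distrib, add_div]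

theorem kernelMean_smul (c : ℂ) (T : Matrix W W ℂ) :
    kernelMean G t (c • T) = c * kernelMean G t T := by
  simp only [kernelMean, Matrix.smul_apply, smul_eq_mul, mul_assoc, ← Finset.mul_sum,
    mul_div_assoc]

theorem kernelMean_star (T : Matrix W W ℂ) :
    kernelMean G t (star T) = star (kernelMean G t T) := by
  simp only [kernelMean, Matrix.star_apply, Complex.star_def, map_div₀, map_sum, map_mul,
    Complex.conj_ofReal, Complex.conj_natCast]
  rw [Finset.sum_comm]
  simp only [G.dist_comm]

theorem kernelMean_one [DecidableEq W] [Nonempty W] : kernelMean G t 1 = 1 := by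
  have hcard : (Fintype.card W : ℂ) ≠ 0 := Nat.cast_ne_zero.2 Fintype.card_ne_zero
  simp [kernelMean, Matrix.one_apply, hcard]

variable {t}

theorem norm_pow_le_one (ht : |t| ≤ 1) (k : ℕ) : ‖((t ^ k : ℝ) : ℂ)‖ ≤ 1 := by
  rw [Complex.norm_real, Real.norm_eq_abs, abs_pow]
  exact pow_le_one₀ (abs_nonneg t) ht

theorem sum_div_card_le {a : W → ℝ} {B : ℝ} (hB : 0 ≤ B) (ha : ∀ x, a x ≤ B) :
    (∑ x, a x) / Fintype.card W ≤ B := by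
  refine div_le_of_le_mul₀ (Nat.cast_nonneg _) hB ?_
  calc ∑ x, a x ≤ Fintype.card W • B := Finset.sum_le_card_nsmul _ _ B fun x _ => ha x
    _ = B * Fintype.card W := by rw [nsmul_eq_mul, mul_comm]

theorem norm_kernelMean_le (ht : |t| ≤ 1) {T : Matrix W W ℂ} {C : ℝ} (hC : 0 ≤ C)
    (hT : ∀ x, ∑ y, ‖T x y‖ ≤ C) : ‖kernelMean G t T‖ ≤ C := by
  rw [kernelMean, norm_div, Complex.norm_natCast]
  refine (div_le_div_of_nonneg_right (norm_sum_le _ _) (Nat.cast_nonneg _)).trans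
    (sum_div_card_le hC fun x => (norm_sum_le_of_le _ fun y _ => ?_).trans (hT x))
  rw [norm_mul]
  exact mul_le_of_le_one_right (norm_nonneg _) (norm_pow_le_one ht _)

/-! ### Almost positivity -/

theorem kernelMean_star_mul_self (S : Matrix W W ℂ) : kernelMean G t (star S * S) =
    (∑ z, ∑ x, ∑ y, star (S z x) * S z y * ((t ^ G.dist x y : ℝ) : ℂ)) /
      (Fintype.card W : ℂ) := by
  simp only [kernelMean, Matrix.mul_apply, Matrix.star_apply, Finset.sum_mul]
  refine congrArg (· / _) ?_
  calc _ = ∑ x, ∑ z, ∑ y, star (S z x) * S z y * ((t ^ G.dist x y : ℝ) : ℂ) :=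
        Finset.sum_congr rfl fun x _ => Finset.sum_comm
    _ = _ := Finset.sum_comm

theorem neg_sq_le_re_sum_pow_dist (ht : |t| ≤ 1) {a : W → ℂ} {C : ℝ} (ha : ∑ x, ‖a x‖ ≤ C) :
    -C ^ 2 ≤ (∑ x, ∑ y, star (a x) * a y * ((t ^ G.dist x y : ℝ) : ℂ)).re := by
  have hnonneg : 0 ≤ ∑ x, ‖a x‖ := Finset.sum_nonneg fun _ _ => norm_nonneg _
  have hnorm : ‖∑ x, ∑ y, star (a x) * a y * ((t ^ G.dist x y : ℝ) : ℂ)‖ ≤ C ^ 2 := calc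
    _ ≤ ∑ x, ∑ y, ‖a x‖ * ‖a y‖ := by
      refine norm_sum_le_of_le _ fun x _ => norm_sum_le_of_le _ fun y _ => ?_
      rw [norm_mul, norm_mul, norm_star]
      exact mul_le_of_le_one_right (by positivity) (norm_pow_le_one ht _)
    _ = (∑ x, ‖a x‖) ^ 2 := by rw [sq, Finset.sum_mul_sum]
    _ ≤ C ^ 2 := pow_le_pow_left₀ hnonneg ha 2
  exact (abs_le.1 ((Complex.abs_re_le_norm _).trans hnorm)).1

variable {G}

theorem neg_le_re_kernelMean_star_mul_self (hG : G.Connected) (ht : |t| ≤ 1) {S : Matrix W W ℂ}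
    {s N : ℕ} {C : ℝ} (hS : ∀ z x, S z x ≠ 0 → G.dist x z ≤ s) (hC : ∀ z, ∑ x, ‖S z x‖ ≤ C)
    (hN : ∀ x, {y | G.dist x y ≤ 3 * s}.ncard ≤ N) :
    -(C ^ 2 * (2 * N) * ((detourEdges G (2 * (3 * s))).ncard / (Fintype.card W : ℝ))) ≤
      (kernelMean G t (star S * S)).re := by
  classical
  let q : W → ℂ := fun z => ∑ x, ∑ y, star (S z x) * S z y * ((t ^ G.dist x y : ℝ) : ℂ)
  have hq : ∀ z, (if z ∈ nearDetours G (3 * s) then -C ^ 2 else 0) ≤ (q z).re := fun z => by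
    split_ifs with hz
    · exact neg_sq_le_re_sum_pow_dist G ht (hC z)
    · exact re_sum_pow_dist_nonneg hG (fun x y hx he => hz ⟨x, y, hx, he⟩)
        ((sq_le_one_iff_abs_le_one t).2 ht) (S z) (hS z)
  have hsum : -(C ^ 2 * (2 * N) * (detourEdges G (2 * (3 * s))).ncard) ≤ ∑ z, (q z).re := calc
    _ = C ^ 2 * -(((detourEdges G (2 * (3 * s))).ncard * (2 * N) : ℕ) : ℝ) := by push_cast; ring
    _ ≤ C ^ 2 * -((nearDetours G (3 * s)).ncard : ℝ) := by
      gcongr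
      exact ncard_nearDetours_le hN
    _ = ∑ z, if z ∈ nearDetours G (3 * s) then -C ^ 2 else 0 := by
      rw [← Finset.sum_filter, Finset.sum_const, nsmul_eq_mul, ← Set.ncard_coe_finset,
        Finset.coe_filter_univ, Set.ofPred_mem_eq]
      ring
    _ ≤ _ := Finset.sum_le_sum fun z _ => hq z
  rw [kernelMean_star_mul_self, ← Complex.ofReal_natCast, Complex.div_ofReal_re, Complex.re_sum,
    ← mul_div_assoc, ← neg_div]
  exact div_le_div_of_nonneg_right hsum (Nat.cast_nonneg _)

/-! ### Upper bounds -/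

theorem re_kernelMean_map_ofReal_le {a : Matrix W W ℝ} {B : ℝ} (hB : 0 ≤ B)
    (h : ∀ x, ∑ y, a x y * t ^ G.dist x y ≤ B) :
    (kernelMean G t (a.map Complex.ofRealHom)).re ≤ B := by
  simp only [kernelMean, Matrix.map_apply, Complex.ofRealHom_eq_coe, ← Complex.ofReal_mul,
    ← Complex.ofReal_sum, ← Complex.ofReal_natCast, ← Complex.ofReal_div, Complex.ofReal_re]
  exact sum_div_card_le hB h

variable (ht0 : 0 ≤ t) (ht1 : t ≤ 1)
include ht0 ht1

theorem re_kernelMean_map_ofReal_le_of_spread {D N : ℕ} {δ : ℝ} (hδ : 0 ≤ δ) {a : Matrix W W ℝ}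
    (hN : ∀ x, {y | G.dist x y ≤ D}.ncard ≤ N) (ha : ∀ x y, 0 ≤ a x y)
    (hsum : ∀ x, ∑ y, a x y = 1) (haδ : ∀ x y, a x y ≤ δ) :
    (kernelMean G t (a.map Complex.ofRealHom)).re ≤ N * δ + t ^ D := by
  classical
  refine re_kernelMean_map_ofReal_le (by positivity) fun x => ?_
  have hterm : ∀ y, a x y * t ^ G.dist x y ≤
      (if G.dist x y ≤ D then δ else 0) + a x y * t ^ D := fun y => by
    split_ifs with hy
    · exact ((mul_le_of_le_one_right (ha x y) (pow_le_one₀ ht0 ht1)).trans (haδ x y)).trans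
        (le_add_of_nonneg_right (mul_nonneg (ha x y) (pow_nonneg ht0 D)))
    · rw [zero_add]
      exact mul_le_mul_of_nonneg_left (pow_le_pow_of_le_one ht0 ht1 (not_le.1 hy).le) (ha x y)
  calc ∑ y, a x y * t ^ G.dist x y
      ≤ ∑ y, ((if G.dist x y ≤ D then δ else 0) + a x y * t ^ D) :=
        Finset.sum_le_sum fun y _ => hterm y
    _ = {y | G.dist x y ≤ D}.ncard * δ + t ^ D := by
        rw [Finset.sum_add_distrib, ← Finset.sum_mul, hsum, one_mul, ← Finset.sum_filter,
          Finset.sum_const, nsmul_eq_mul, ← Set.ncard_coe_finset, Finset.coe_filter_univ]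
    _ ≤ N * δ + t ^ D := by
        gcongr
        exact hN x

theorem re_kernelMean_lapMatrix_le [DecidableEq W] {X : SimpleGraph W} [DecidableRel X.Adj]
    {d L : ℕ} (hd : ∀ x, X.degree x ≤ d) (hL : ∀ x y, X.Adj x y → G.dist x y ≤ L) :
    (kernelMean G t (X.lapMatrix ℂ)).re ≤ d * (1 - t ^ L) := by
  have hB : 0 ≤ 1 - t ^ L := sub_nonneg.2 (pow_le_one₀ ht0 ht1)
  have hreal : X.lapMatrix ℂ = (X.lapMatrix ℝ).map Complex.ofRealHom := by
    ext x y
    simp only [SimpleGraph.lapMatrix, SimpleGraph.degMatrix, Matrix.sub_apply, Matrix.map_apply,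
      Matrix.diagonal_apply, SimpleGraph.adjMatrix_apply, map_sub]
    split_ifs <;> simp
  rw [hreal]
  refine re_kernelMean_map_ofReal_le (mul_nonneg d.cast_nonneg hB) fun x => ?_
  have hadj : X.degree x * t ^ L ≤ ∑ y ∈ X.neighborFinset x, t ^ G.dist x y := by
    rw [← X.card_neighborFinset_eq_degree, ← nsmul_eq_mul]
    exact Finset.card_nsmul_le_sum _ _ _ fun y hy =>
      pow_le_pow_of_le_one ht0 ht1 (hL x y ((X.mem_neighborFinset x y).1 hy))
  calc ∑ y, X.lapMatrix ℝ x y * t ^ G.dist x y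
      = X.degree x - ∑ y ∈ X.neighborFinset x, t ^ G.dist x y := by
        simpa [Matrix.mulVec, dotProduct] using
          X.lapMatrix_mulVec_apply x fun y => t ^ G.dist x y
    _ ≤ X.degree x - X.degree x * t ^ L := sub_le_sub_left hadj _
    _ = X.degree x * (1 - t ^ L) := by ring
    _ ≤ d * (1 - t ^ L) := mul_le_mul_of_nonneg_right (Nat.cast_le.2 (hd x)) hB

end KernelMean

/-! ### The limit functional -/

section PositiveFunctional

variable {A : Type*} [Ring A] [StarRing A] [Algebra ℂ A] {f : A →ₗ[ℂ] ℂ}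

theorem re_apply_star_add_mul_add_le (hf : ∀ a, 0 ≤ (f (star a * a)).re) (a b : A) :
    (f (star (a + b) * (a + b))).re ≤
      2 * (f (star a * a)).re + 2 * (f (star b * b)).re := by
  have hpar : star (a + b) * (a + b) + star (a - b) * (a - b) =
      star a * a + star a * a + (star b * b + star b * b) := by
    rw [star_add, star_sub]
    noncomm_ring
  have hpar' := congrArg (fun c => (f c).re) hpar
  simp only [map_add, Complex.add_re] at hpar'
  linarith [hf (a - b)]

theorem re_apply_star_mul_mul_le (hf : ∀ a, 0 ≤ (f (star a * a)).re) {a b : A} {c : ℝ}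
    (hab : star a * a + star b * b = algebraMap ℂ A c) (v : A) :
    (f (star (a * v) * (a * v))).re ≤ c * (f (star v * v)).re := by
  have hsum : star (a * v) * (a * v) + star (b * v) * (b * v) = (c : ℂ) • (star v * v) := calc
    _ = star v * (star a * a + star b * b) * v := by
      rw [star_mul, star_mul]
      noncomm_ring
    _ = _ := by
      rw [hab, ← Algebra.commutes, mul_assoc, Algebra.smul_def]
  have hsum' := congrArg (fun z => (f z).re) hsum
  simp only [map_add, map_smul, Complex.add_re, smul_eq_mul, Complex.re_ofReal_mul] at hsum'
  linarith [hf (b * v)]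

theorem exists_re_apply_star_sum_mul_le (hf : ∀ a, 0 ≤ (f (star a * a)).re) {a b : ℕ → A} {c : ℝ}
    (hab : ∀ k, star (a k) * a k + star (b k) * b k = algebraMap ℂ A c) (N : ℕ) :
    ∃ C : ℝ, 0 ≤ C ∧ ∀ v, (f (star ((∑ k ∈ Finset.range N, a k) * v) *
      ((∑ k ∈ Finset.range N, a k) * v))).re ≤ C * (f (star v * v)).re := by
  induction N with
  | zero => exact ⟨0, le_rfl, fun v => by simp⟩
  | succ N ih =>
    obtain ⟨C, hC0, hC⟩ := ih
    refine ⟨2 * C + 2 * |c|, by positivity, fun v => ?_⟩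
    rw [Finset.sum_range_succ, add_mul]
    have hN := (re_apply_star_mul_mul_le hf (hab N) v).trans
      (mul_le_mul_of_nonneg_right (le_abs_self c) (hf v))
    refine (re_apply_star_add_mul_add_le hf _ _).trans ?_
    linarith [hC v]

end PositiveFunctional

section LimitFunctional

variable {V : ℕ → Type u} [∀ n, Fintype (V n)] [∀ n, DecidableEq (V n)]
variable {X : ∀ n, SimpleGraph (V n)} [UniformlyBoundedDegree X]

namespace AlgebraicRoe

theorem exists_row_sum_bound (T : AlgebraicRoe X) :
    ∃ C : ℝ, 0 ≤ C ∧ ∀ n x, ∑ y, ‖T.entries n x y‖ ≤ C := by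
  classical
  obtain ⟨R, hR⟩ := T.finitePropagation_entries
  obtain ⟨M, hM⟩ := T.norm_entries_le
  obtain ⟨N, hN⟩ := exists_ball_bound X R
  refine ⟨N * |M|, by positivity, fun n x => ?_⟩
  have hsupp : ∀ y ∉ {y | (X n).edist x y ≤ R}.toFinset, ‖T.entries n x y‖ = 0 := fun y hy => by
    rw [Set.mem_toFinset, Set.mem_ofPred_eq] at hy
    rw [norm_eq_zero]
    exact of_not_not fun hne => hy (hR n x y hne)
  calc ∑ y, ‖T.entries n x y‖
      = ∑ y ∈ {y | (X n).edist x y ≤ R}.toFinset, ‖T.entries n x y‖ :=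
        (Finset.sum_subset (Finset.subset_univ _) fun y _ => hsupp y).symm
    _ ≤ {y | (X n).edist x y ≤ R}.toFinset.card • |M| :=
        Finset.sum_le_card_nsmul _ _ _ fun y _ => (hM n x y).trans (le_abs_self M)
    _ ≤ N * |M| := by
        rw [nsmul_eq_mul, ← Set.ncard_eq_toFinset_card']
        gcongr
        exact hN n x

theorem exists_eq_sum_of_star_mul_self_add_eq (T : AlgebraicRoe X) :
    ∃ (N : ℕ) (c : ℝ) (a b : ℕ → AlgebraicRoe X), T = ∑ k ∈ Finset.range N, a k ∧
      ∀ k, star (a k) * a k + star (b k) * b k = algebraMap ℂ (AlgebraicRoe X) (c : ℂ) := by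
  obtain ⟨M, hM⟩ := T.norm_entries_le
  obtain ⟨N, c, A, B, hsum, hAB⟩ :=
    exists_row_decomposition X T.entries T.finitePropagation_entries M hM
  let a : ℕ → AlgebraicRoe X := fun k =>
    ⟨A k, isBoundedSeq_of_star_mul_add _ _ c (hAB k).2.2, (hAB k).1⟩
  let b : ℕ → AlgebraicRoe X := fun k =>
    ⟨B k, isBoundedSeq_of_star_mul_add _ _ c ((add_comm _ _).trans (hAB k).2.2), (hAB k).2.1⟩
  refine ⟨N, c, a, b, ext fun n x y => ?_, fun k => Subtype.ext (hAB k).2.2⟩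
  rw [entries_sum, hsum, Finset.sum_apply, Matrix.sum_apply]
  rfl

theorem exists_re_apply_star_mul_le {f : AlgebraicRoe X →ₗ[ℂ] ℂ}
    (hf : ∀ a, 0 ≤ (f (star a * a)).re) (T : AlgebraicRoe X) :
    ∃ C : ℝ, 0 ≤ C ∧ ∀ v, (f (star (T * v) * (T * v))).re ≤ C ^ 2 * (f (star v * v)).re := by
  obtain ⟨N, c, a, b, rfl, hab⟩ := T.exists_eq_sum_of_star_mul_self_add_eq
  obtain ⟨C, hC0, hC⟩ := exists_re_apply_star_sum_mul_le hf hab N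
  exact ⟨√C, Real.sqrt_nonneg C, by rwa [Real.sq_sqrt hC0]⟩

end AlgebraicRoe

variable {Y : ∀ n, SimpleGraph (V n)} {t : ℝ}

theorem exists_neg_le_re_kernelMean (hXY : SameCoarseStructure X Y) (ht : |t| ≤ 1)
    (S : AlgebraicRoe X) :
    ∃ (C : ℝ) (k : ℕ), ∀ n, -(C * ((detourEdges (Y n) k).ncard / (Fintype.card (V n) : ℝ))) ≤
      (kernelMean (Y n) t ((star S * S).entries n)).re := by
  obtain ⟨R, hR⟩ := S.finitePropagation_entries
  obtain ⟨L, hL⟩ := hXY.exists_nat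
  obtain ⟨C, -, hC⟩ := S.exists_row_sum_bound
  obtain ⟨N, hN⟩ := hXY.exists_ball_bound (3 * (L * R))
  have hS : ∀ n z x, S.entries n z x ≠ 0 → (Y n).dist x z ≤ L * R := fun n z x hzx => by
    have hdist : (X n).dist z x ≤ R := by
      have hedist := hR n z x hzx
      rwa [← ((hXY.1 n).preconnected z x).coe_dist_eq_edist, Nat.cast_le] at hedist
    rw [(Y n).dist_comm]
    exact (hL n z x).2.trans (Nat.mul_le_mul_left L hdist)
  refine ⟨C ^ 2 * (2 * N), 2 * (3 * (L * R)), fun n => ?_⟩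
  rw [map_mul, map_star]
  exact neg_le_re_kernelMean_star_mul_self (hXY.2.1 n) ht (hS n) (hC n) (hN n)

theorem exists_tendsto_ultrafilter_of_norm_le {ι : Type*} (U : Ultrafilter ι) {g : ι → ℂ} {C : ℝ}
    (hg : ∀ i, ‖g i‖ ≤ C) : ∃ z, Tendsto g U (𝓝 z) := by
  have hball : ((U.map g : Ultrafilter ℂ) : Filter ℂ) ≤ 𝓟 (Metric.closedBall 0 C) :=
    le_principal_iff.2 (mem_map.2 (univ_mem' fun i => mem_closedBall_zero_iff.2 (hg i)))
  obtain ⟨z, -, hz⟩ := (isCompact_closedBall (0 : ℂ) C).ultrafilter_le_nhds _ hball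
  exact ⟨z, hz⟩

theorem exists_boundedPositiveFunctional_tendsto_kernelMean (hXY : SameCoarseStructure X Y)
    (ht : |t| ≤ 1) (U : Ultrafilter ℕ)
    (hU : ∀ k, Tendsto (fun n => ((detourEdges (Y n) k).ncard / Fintype.card (V n) : ℝ)) U (𝓝 0)) :
    ∃ f : BoundedPositiveFunctional (AlgebraicRoe X),
      ∀ T, Tendsto (fun n => kernelMean (Y n) t (T.entries n)) U (𝓝 (f.toLin T)) := by
  have hlim : ∀ T : AlgebraicRoe X, ∃ z,
      Tendsto (fun n => kernelMean (Y n) t (T.entries n)) U (𝓝 z) := fun T => by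
    obtain ⟨C, hC0, hC⟩ := T.exists_row_sum_bound
    exact exists_tendsto_ultrafilter_of_norm_le U fun n =>
      norm_kernelMean_le (Y n) ht hC0 (hC n)
  choose f hf using hlim
  let F : AlgebraicRoe X →ₗ[ℂ] ℂ :=
    { toFun := f
      map_add' := fun S T => tendsto_nhds_unique (hf (S + T)) <| by
        simpa only [map_add, Pi.add_apply, kernelMean_add] using (hf S).add (hf T)
      map_smul' := fun c T => tendsto_nhds_unique (hf (c • T)) <| by
        simpa only [map_smul, Pi.smul_apply, kernelMean_smul, RingHom.id_apply, smul_eq_mul] using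
          (hf T).const_mul c }
  have hpos : ∀ S, 0 ≤ (F (star S * S)).re := fun S => by
    obtain ⟨C, k, hC⟩ := exists_neg_le_re_kernelMean hXY ht S
    have hzero := ((hU k).const_mul C).neg
    rw [mul_zero, neg_zero] at hzero
    exact le_of_tendsto_of_tendsto' hzero ((Complex.continuous_re.tendsto _).comp (hf _)) hC
  have hstar : ∀ T, f (star T) = star (f T) := fun T => tendsto_nhds_unique (hf (star T)) <| by
    simpa only [map_star, Pi.star_apply, kernelMean_star] using (hf T).star
  exact ⟨⟨F, hstar, hpos, AlgebraicRoe.exists_re_apply_star_mul_le hpos⟩, hf⟩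

end LimitFunctional

/-! ### Geometric property (T) and detours -/

section Detours

variable {V : ℕ → Type u} [∀ n, Fintype (V n)]

theorem exists_ultrafilter_tendsto_detourEdges {Y : ∀ n, SimpleGraph (V n)}
    (hne : ∀ n, Nonempty (V n))
    (hfew : ∀ (k : ℕ) (ε : ℝ), 0 < ε →
      ∃ᶠ n in atTop, ((detourEdges (Y n) k).ncard : ℝ) < ε * Fintype.card (V n)) :
    ∃ U : Ultrafilter ℕ, (U : Filter ℕ) ≤ atTop ∧ ∀ k, Tendsto
      (fun n => ((detourEdges (Y n) k).ncard / Fintype.card (V n) : ℝ)) U (𝓝 0) := by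
  choose m hm hlt using fun j : ℕ =>
    frequently_atTop.1 (hfew j (1 / ((j : ℝ) + 1)) (by positivity)) j
  have hm_atTop : Tendsto m atTop atTop := tendsto_atTop_mono hm tendsto_id
  have hU : ((Ultrafilter.of atTop).map m : Filter ℕ) ≤ map m atTop :=
    Filter.map_mono (Ultrafilter.of_le _)
  refine ⟨(Ultrafilter.of atTop).map m, hU.trans hm_atTop, fun k => ?_⟩
  refine Tendsto.mono_left (tendsto_map'_iff.2 ?_) hU
  refine squeeze_zero' (.of_forall fun j => div_nonneg (Nat.cast_nonneg _) (Nat.cast_nonneg _)) ?_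
    (tendsto_one_div_add_atTop_nhds_zero_nat (𝕜 := ℝ))
  filter_upwards [eventually_ge_atTop k] with j hj
  have hmono : (detourEdges (Y (m j)) k).ncard ≤ (detourEdges (Y (m j)) j).ncard :=
    Set.ncard_le_ncard (fun e ⟨he, x, y, p, hp⟩ => ⟨he, x, y, p, hp.1, hp.2.1, hp.2.2.trans hj⟩)
      (Set.toFinite _)
  have := hne (m j)
  rw [Function.comp_apply, div_le_iff₀ (Nat.cast_pos.2 Fintype.card_pos)]
  exact (Nat.cast_le.2 hmono).trans (hlt j).le

theorem exists_mul_one_sub_pow_le (d L : ℕ) {η : ℝ} (hη : 0 < η) :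
    ∃ t : ℝ, 0 ≤ t ∧ t < 1 ∧ d * (1 - t ^ L) ≤ η := by
  have hlim : Tendsto (fun t : ℝ => d * (1 - t ^ L)) (𝓝[<] 1) (𝓝 (d * (1 - 1 ^ L))) :=
    Continuous.continuousWithinAt (by fun_prop)
  rw [one_pow, sub_self, mul_zero] at hlim
  obtain ⟨t, htη, ht⟩ := ((hlim.eventually (eventually_le_nhds hη)).and
    (Ioo_mem_nhdsLT (zero_lt_one' ℝ))).exists
  exact ⟨t, ht.1.le, ht.2, htη⟩

variable [∀ n, DecidableEq (V n)] {X : ∀ n, SimpleGraph (V n)} [UniformlyBoundedDegree X]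

theorem BoundedPositiveFunctional.mul_re_apply_one_le
    (f : BoundedPositiveFunctional (AlgebraicRoe X)) {γ : ℝ} (hγ : 0 < γ)
    (hspec : spectrum ℂ ((roeLaplacian X : AlgebraicRoe X) : MaxRoe X) ⊆
      {0} ∪ Complex.ofReal '' Set.Ici γ) {A : AlgebraicRoe X}
    (hA : IsStarProjection A) (hsum : ∀ n x, ∑ y, A.entries n x y = 1) :
    γ * (f.toLin 1).re ≤ γ * (f.toLin A).re + (f.toLin (roeLaplacian X)).re := by
  let π : RoeRepresentation X := { H := UniformSpace.Completion f.PreGNS, hom := f.gns }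
  let Ω : π.H := ((f.toPreGNS 1 : f.PreGNS) : UniformSpace.Completion f.PreGNS)
  have hΩ : ∀ T, inner ℂ Ω (π.hom T Ω) = f.toLin T := f.inner_gns_apply
  have hnorm : ‖Ω‖ ^ 2 = (f.toLin 1).re := by
    rw [← hΩ, map_one, one_apply_eq_self]
    exact (inner_self_eq_norm_sq (𝕜 := ℂ) Ω).symm
  have hself : IsSelfAdjoint (π.hom (roeLaplacian X)) := .map star_roeLaplacian π.hom
  rw [← hnorm, ← hΩ, ← hΩ]
  exact mul_norm_sq_le_of_isStarProjection hself hγ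
    ((spectrum_hom_subset_spectrum_coe X π _).trans hspec) (hA.map π.hom)
    (fun w hw => map_eq_self_of_map_roeLaplacian π.hom hw A hsum) Ω

variable {Y : ∀ n, SimpleGraph (V n)} (hXY : SameCoarseStructure X Y)
include hXY

theorem SameCoarseStructure.exists_re_kernelMean_roeLaplacian_le {η : ℝ} (hη : 0 < η) :
    ∃ t : ℝ, 0 ≤ t ∧ t < 1 ∧ ∀ n, (kernelMean (Y n) t ((roeLaplacian X).entries n)).re ≤ η := by
  classical
  obtain ⟨d, hd⟩ := UniformlyBoundedDegree.exists_bound (X := X)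
  obtain ⟨L, hL⟩ := hXY.exists_nat
  obtain ⟨t, ht0, ht1, ht⟩ := exists_mul_one_sub_pow_le d L hη
  refine ⟨t, ht0, ht1, fun n => le_trans ?_ ht⟩
  refine re_kernelMean_lapMatrix_le (X := X n) ht0 ht1.le
    (fun x => (Set.ncard_eq_toFinset_card' _).symm.trans_le (hd n x)) fun x y hxy => ?_
  simpa only [SimpleGraph.dist_eq_one_iff_adj.2 hxy, mul_one] using (hL n x y).2

theorem SameCoarseStructure.exists_isStarProjection_re_kernelMean_le {t : ℝ} (ht0 : 0 ≤ t)
    (ht1 : t < 1) {η : ℝ} (hη : 0 < η) :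
    ∃ A : AlgebraicRoe X, IsStarProjection A ∧ (∀ n x, ∑ y, A.entries n x y = 1) ∧
      ∃ ρ, ∀ n, ρ ≤ Fintype.card (V n) → (kernelMean (Y n) t (A.entries n)).re ≤ η := by
  obtain ⟨D, hD⟩ := exists_pow_lt_of_lt_one (half_pos hη) ht1
  obtain ⟨N, hN⟩ := hXY.exists_ball_bound D
  obtain ⟨ρ, hρ⟩ := exists_nat_ge (N / (η / 2))
  obtain ⟨A, a, hA, haA, ha0, hasum, haρ⟩ := exists_averaging_projection X hXY.1 ρ
  refine ⟨A, hA, fun n x => ?_, ρ + 1, fun n hn => ?_⟩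
  · simpa [haA] using congrArg Complex.ofReal (hasum n x)
  · have hNρ : N * ((ρ + 1 : ℕ) : ℝ)⁻¹ ≤ η / 2 := by
      rw [← div_eq_mul_inv, div_le_iff₀ (by positivity), ← div_le_iff₀' (by positivity)]
      exact hρ.trans (Nat.cast_le.2 ρ.le_succ)
    calc _ ≤ N * ((ρ + 1 : ℕ) : ℝ)⁻¹ + t ^ D := by
          rw [haA]
          exact re_kernelMean_map_ofReal_le_of_spread ht0 ht1.le (by positivity) (hN n) (ha0 n)
            (hasum n) (haρ n hn)
      _ ≤ η := by linarith

theorem SameCoarseStructure.exists_not_tendsto_detourEdges {γ : ℝ} (hγ : 0 < γ)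
    (hspec : spectrum ℂ ((roeLaplacian X : AlgebraicRoe X) : MaxRoe X) ⊆
      {0} ∪ Complex.ofReal '' Set.Ici γ) {U : Ultrafilter ℕ}
    (hcard : Tendsto (fun n => Fintype.card (V n)) U atTop) :
    ∃ k, ¬ Tendsto (fun n => ((detourEdges (Y n) k).ncard / Fintype.card (V n) : ℝ)) U (𝓝 0) := by
  by_contra! hU
  obtain ⟨t, ht0, ht1, ht⟩ := hXY.exists_re_kernelMean_roeLaplacian_le (η := γ / 4) (by positivity)
  obtain ⟨A, hA, hAsum, ρ, hAρ⟩ :=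
    hXY.exists_isStarProjection_re_kernelMean_le ht0 ht1 (η := 1 / 2) (by positivity)
  obtain ⟨f, hf⟩ := exists_boundedPositiveFunctional_tendsto_kernelMean hXY
    ((abs_of_nonneg ht0).trans_le ht1.le) U hU
  have hre : ∀ T : AlgebraicRoe X,
      Tendsto (fun n => (kernelMean (Y n) t (T.entries n)).re) U (𝓝 (f.toLin T).re) :=
    fun T => (Complex.continuous_re.tendsto _).comp (hf T)
  have hone : (f.toLin 1).re = 1 := by
    refine tendsto_nhds_unique (hre 1) (tendsto_const_nhds.congr fun n => ?_)
    have := (hXY.1 n).nonempty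
    rw [map_one, Pi.one_apply, kernelMean_one, Complex.one_re]
  have hlap : (f.toLin (roeLaplacian X)).re ≤ γ / 4 := le_of_tendsto' (hre _) ht
  have hproj : γ * (f.toLin A).re ≤ γ * (1 / 2) := by
    gcongr
    exact le_of_tendsto (hre A) ((hcard.eventually_ge_atTop ρ).mono hAρ)
  have hgap := f.mul_re_apply_one_le hγ hspec hA hAsum
  rw [hone] at hgap
  linarith

end Detours

namespace GeometricPropertyT

variable {V : ℕ → Type u} [∀ n, Fintype (V n)] [∀ n, DecidableEq (V n)]
variable {X Y : ∀ n, SimpleGraph (V n)}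

theorem exists_detourEdges (hT : GeometricPropertyT X) (hXY : SameCoarseStructure X Y) :
    ∃ (k : ℕ) (ε : ℝ), 0 < ε ∧ ∀ᶠ n in atTop,
      ε * (Fintype.card (V n) : ℝ) ≤ ((detourEdges (Y n) k).ncard : ℝ) := by
  obtain ⟨hconn, hcard, hdeg, γ, hγ, hspec⟩ := hT
  by_contra! hfew
  obtain ⟨U, hU, hlim⟩ :=
    exists_ultrafilter_tendsto_detourEdges (fun n => (hconn n).nonempty) hfew
  obtain ⟨k, hk⟩ := hXY.exists_not_tendsto_detourEdges hγ hspec (hcard.mono_left hU)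
  exact hk (hlim k)

theorem combinatorialCost_lt (hT : GeometricPropertyT X) (hXY : SameCoarseStructure X Y) :
    combinatorialCost X < liminfEdgeDensity Y := by
  obtain ⟨k, ε, hε, hdetour⟩ := hT.exists_detourEdges hXY
  have : UniformlyBoundedDegree X := hT.2.2.choose
  obtain ⟨d, hd⟩ := hXY.exists_degree_bound
  have hd' : DegreeAtMost Y (d + 1) := fun n x => (hd n x).trans d.le_succ
  calc combinatorialCost X ≤ liminfEdgeDensity Y - ε / ((d + 1 : ℕ) : ℝ) ^ k :=
        combinatorialCost_le_sub hXY hd' hdetour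
    _ < liminfEdgeDensity Y := sub_lt_self _ (by positivity)

end GeometricPropertyT

theorem mainTheorem4 {V : ℕ → Type u} [∀ n, Fintype (V n)] [∀ n, DecidableEq (V n)]
    (X : ∀ n, SimpleGraph (V n)) (hconn : ∀ n, (X n).Connected) :
    (∀ d : ℕ, DegreeAtMost X d → ∀ (R : ℕ) (ε : ℝ), 0 < R → 0 < ε →
      (∀ n, ε * (Fintype.card (V n) : ℝ) ≤
        (Module.finrank ℝ (shortCycleSpace (X n) R) : ℝ)) →
      combinatorialCost X ≤ liminfEdgeDensity X - ε / (d : ℝ) ^ (R - 1)) ∧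
    (GeometricPropertyT X →
      ¬ ∃ Y : ∀ n, SimpleGraph (V n),
        SameCoarseStructure X Y ∧ liminfEdgeDensity Y = combinatorialCost X) := by
  refine ⟨fun d hd R ε _ _ hZ => combinatorialCost_le_of_shortCycleSpace hconn hd hZ, ?_⟩
  rintro hT ⟨Y, hXY, hY⟩
  exact (hT.combinatorialCost_lt hXY).ne' hY
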